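/- Let $M$ be a smooth manifold (finite-dimensional, Hausdorff, second countable), $S\subset M$ a closed subset, and $I_S\subset C^\infty(M)$ the ideal of functions vanishing on $S$. Vector fields are identified with derivations of $C^\infty(M)$, and $n$-forms with alternating $C^\infty(M)$-multilinear maps $\mathfrak X(M)^n\to C^\infty(M)$, with $d$ the Chevalley--Eilenberg differential, $\iota_X$ insertion into the first slot and $\mathcal L_X=\iota_Xd+d\iota_X$. For the constraint algebra $A=(C^\infty(M),C^\infty(M),I_S)$ put $$\mathfrak X(A)_W=\{X\mid X(I_S)\subset I_S\},\qquad \mathfrak X(A)_0=\{X\mid X(C^\infty(M))\subset I_S\},$$ $$B_0^n=\{\alpha\in\Omega^n(M)\mid \alpha(v_1,\dots,v_n)\in I_S\ \ \forall v_i\in\mathfrak X(A)_W\},\qquad B_W^n=\{\alpha\in\Omega^n(M)\mid \iota_w\alpha\in B_0\ \ \forall w\in\mathfrak X(A)_0\},$$ so that $B_0=\mathrm{CE}(\mathfrak X(A))_0$ and $B_W=\mathrm{CE}(\mathfrak X(A))_W$. Let $F\subset\mathfrak X(A)_W$ be a Lie subalgebra, let $k\ge 1$, and let $\omega\in\Omega^{k+1}(M)$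 be closed with $\omega(F,\mathfrak X(A)_W,\dots,\mathfrak X(A)_W)|_S=0$. Let $\mathcal F$ be the smallest $C^\infty(M)$-submodule of $\mathfrak X(M)$ that is closed under the Lie bracket and contains $F$ and $\mathfrak X(A)_0$. Put $$\mathfrak Y_W=\{X\in\mathfrak X(A)_W\mid[\mathcal F,X]\subset\mathcal F\},\qquad B'_W=\{\alpha\in B_W\mid \iota_\xi\alpha,\ \mathcal L_\xi\alpha\in B_0\ \ \forall\xi\in\mathcal F\},\qquad B'_0=B_0 .$$ The observables $\mathrm{Ham}(M,\omega)$ consist of $\mathrm{Ham}^0=\{(\alpha,X)\in\Omega^{k-1}(M)\oplus\mathfrak X(M)\mid\iota_X\omega=-d\alpha\}$ in degree $0$ and $\mathrm{Ham}^{i}=\Omega^{k-1+i}(M)$ in degrees $i=-1,\dots,-(k-1)$, with the brackets $l_1=d$ in degrees $i<-1$, $l_1(\alpha)=(d\alpha,0)$ for $i=-1$, $l_1=0$ for $i=0$, $$l_2\big((\alpha,X),(\beta,Y)\big)=(-\iota_X\iota_Y\omega,[X,Y]),\qquad l_j\big((\alpha_1,X_1),\dots,(\alpha_j,X_j)\big)=(-1)^{j+1}\iota_{X_1}\cdots\iota_{X_j}\omega\quad(j\ge3),$$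 where $l_j$, $j\ge2$, vanishes if some argument has nonzero degree. Let $\mathrm{Ham}(B',\omega)_W\subset \mathrm{Ham}(M,\omega)$ consist of the forms in $B'_W$ and of the Hamiltonian pairs in $B'_W\oplus\mathfrak Y_W$, and $\mathrm{Ham}(B',\omega)_0$ of the forms in $B'_0$ and of the Hamiltonian pairs in $B'_0\oplus\mathcal F$. Then: 1. $\mathcal F=C^\infty(M)\cdot F+I_S\,\mathfrak X(M)$. 2. $\mathrm{Ham}(M,\omega)$ with these brackets is an $L_\infty$-algebra (with the sign convention $\sum_{i+j=n+1}(-1)^{i(j-1)}\sum_{\sigma}\chi(\sigma)\,l_j(l_i\otimes\mathrm{id})\circ\sigma=0$, where $\sigma$ runs over the $(i,n-i)$-unshuffles and $\chi(\sigma)$ is the signature times the Koszul sign), $\mathrm{Ham}(B',\omega)_0\subset\mathrm{Ham}(B',\omega)_W$, the brackets preserve $\mathrm{Ham}(B',\omega)_W$, and they descend to an $L_\infty$-algebra structure on the graded quotient $\mathrm{Ham}(B',\omega)_W/\mathrm{Ham}(B',\omega)_0$, the reduced $L_\infty$-algebra of observables. 3. The reduced $L_\infty$-algebra of observables is given explicitly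 by $$\frac{\mathrm{Ham}(B',\omega)_W}{\mathrm{Ham}(B',\omega)_0}=\frac{\left\{\begin{array}{l}\alpha\in\Omega^{\le k-2}(M),\text{ respectively}\\(\alpha,X)\in\Omega^{k-1}(M)\oplus\mathfrak X(M)\end{array}\ \middle|\ \begin{array}{l}\iota_\xi\alpha\in B_0,\ \mathcal L_\xi\alpha\in B_0\ \ \forall\xi\in F\\ \hline \iota_X\omega=-d\alpha,\ X\in\mathfrak X(A)_W,\\ {[\xi,X]}\in\mathcal F\ \ \forall\xi\in F\end{array}\right\}}{\left\{\begin{array}{l}\alpha\in\Omega^{\le k-2}(M),\text{ respectively}\\(\alpha,X)\in\Omega^{k-1}(M)\oplus\mathfrak X(M)\end{array}\ \middle|\ \begin{array}{l}\alpha\in B_0\\ \hline \iota_X\omega=-d\alpha,\ X\in\mathcal F\end{array}\right\}},$$ that is, the two numerators coincide and the two denominators coincide (the conditions below the lines apply only to pairs), with $\mathcal F=C^\infty(M)\cdot F+I_S\,\mathfrak X(M)$. -/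

import Mathlib

open scoped Manifold

namespace ConstraintReduction

noncomputable section

section Algebra

/-! ### The Cartan calculus of derivations of a commutative algebra -/

variable (K : Type*) [Field K] [CharZero K] (R : Type*) [CommRing R] [Algebra K R]

/-- The Lie--Rinehart algebra `𝔛(R)` of `K`-linear derivations of `R`. -/
abbrev Der := Derivation K R R

/-- The space `CE^n(𝔛(R)) = (Λ^n_R 𝔛(R))^*` of `n`-forms: `R`-multilinear alternating maps
from `𝔛(R)` to `R`. -/
abbrev Form (n : ℕ) := (Der K R) [⋀^Fin n]→ₗ[R] R

variable {K R}

instance {n : ℕ} : IsScalarTower K R (Form K R n) :=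
  ⟨fun a r α => by ext v; simp⟩

/-- The value of the Chevalley--Eilenberg differential of an `n`-form on `n + 1` derivations
`v₀, …, vₙ`, i.e.
`∑ᵢ (-1)ⁱ vᵢ(α(v₀,…,v̂ᵢ,…,vₙ)) + ∑_{a<b} (-1)^(a+b) α([v_a,v_b],v₀,…,v̂_a,…,v̂_b,…,vₙ)`.
Pairs `a < b` in `Fin (n + 2)` are written `a = i.castSucc`, `b = j.succ` with `i ≤ j`. -/
def ceDiffFun : ∀ {n : ℕ}, Form K R n → (Fin (n + 1) → Der K R) → R
  | 0, α, v => v 0 (α (Fin.removeNth 0 v))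
  | n + 1, α, v =>
      (∑ i : Fin (n + 2), (-1 : ℤ) ^ (i : ℕ) • v i (α (i.removeNth v))) +
      ∑ i : Fin (n + 1), ∑ j ∈ Finset.Ici i, (-1 : ℤ) ^ (i + j + 1 : ℕ) •
        α (Matrix.vecCons ⁅v i.castSucc, v j.succ⁆ (j.removeNth (i.castSucc.removeNth v)))

/-- Auxiliary: a form as a `K`-multilinear alternating map. -/
def auxRestrict {n : ℕ} (α : Form K R n) : (Der K R) [⋀^Fin n]→ₗ[K] R :=
  { α.toMultilinearMap.restrictScalars K with
    map_eq_zero_of_eq' := fun v _ _ h hij => α.map_eq_zero_of_eq v h hij }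

theorem auxRestrict_apply {n : ℕ} (α : Form K R n) (v : Fin n → Der K R) :
    auxRestrict α v = α v := rfl

/-- Auxiliary: `X ↦ X ∘ α`. -/
def auxDeriv {n : ℕ} (α : Form K R n) :
    Der K R →ₗ[K] (Der K R) [⋀^Fin n]→ₗ[K] R where
  toFun X := (X : R →ₗ[K] R).compAlternatingMap (auxRestrict α)
  map_add' X Y := by ext v; simp
  map_smul' c X := by ext v; simp

/-- Auxiliary: `(X, Y) ↦ ι_{[X,Y]} α`. -/
def auxBracket {n : ℕ} (α : Form K R (n + 1)) :
    Der K R →ₗ[K] Der K R →ₗ[K] (Der K R) [⋀^Fin n]→ₗ[K] R :=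
  LinearMap.mk₂ K (fun X Y => (auxRestrict α).curryLeft ⁅X, Y⁆)
    (fun X X' Y => by rw [add_lie, map_add])
    (fun c X Y => by rw [smul_lie, map_smul])
    (fun X Y Y' => by rw [lie_add, map_add])
    (fun c X Y => by rw [lie_smul, map_smul])

/-- Auxiliary: the Chevalley--Eilenberg differential as a `K`-multilinear alternating map. -/
def auxDiff : ∀ {n : ℕ}, Form K R n → (Der K R) [⋀^Fin (n + 1)]→ₗ[K] R
  | 0, α => AlternatingMap.alternatizeUncurryFin (auxDeriv α)
  | _ + 1, α => AlternatingMap.alternatizeUncurryFin (auxDeriv α) - (2⁻¹ : K) •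
      AlternatingMap.alternatizeUncurryFin
        (AlternatingMap.alternatizeUncurryFinLM ∘ₗ auxBracket α)

theorem auxDiff_apply : ∀ {n : ℕ} (α : Form K R n) (v : Fin (n + 1) → Der K R),
    auxDiff α v = ceDiffFun α v
  | 0, α, v => by
      simp [auxDiff, ceDiffFun, AlternatingMap.alternatizeUncurryFin_apply, auxDeriv,
        auxRestrict_apply]
  | n + 1, α, v => by
      have key : ∀ (i j : Fin (n + 1)), (2⁻¹ : K) • ((-1 : ℤ) ^ (i + j : ℕ) •
          (auxBracket α (v i.castSucc) (v j.succ) (j.removeNth (i.castSucc.removeNth v)) -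
            auxBracket α (v j.succ) (v i.castSucc) (j.removeNth (i.castSucc.removeNth v))))
          = - ((-1 : ℤ) ^ (i + j + 1 : ℕ) •
        α (Matrix.vecCons ⁅v i.castSucc, v j.succ⁆ (j.removeNth (i.castSucc.removeNth v)))) := by
        intro i j
        have h1 : auxBracket α (v j.succ) (v i.castSucc)
            = - auxBracket α (v i.castSucc) (v j.succ) := by
          simp only [auxBracket, LinearMap.mk₂_apply]
          rw [← lie_skew, map_neg]
        rw [h1, AlternatingMap.neg_apply, sub_neg_eq_add, ← two_smul K, smul_comm _ (2 : K),
          smul_smul, inv_mul_cancel₀ two_ne_zero, one_smul, pow_succ, mul_neg_one, neg_smul,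
          neg_neg]
        rfl
      simp only [auxDiff, ceDiffFun, AlternatingMap.sub_apply, AlternatingMap.smul_apply]
      rw [AlternatingMap.alternatizeUncurryFin_alternatizeUncurryFinLM_comp_apply,
        AlternatingMap.alternatizeUncurryFin_apply]
      simp only [Finset.smul_sum, key, Finset.sum_neg_distrib, sub_neg_eq_add]
      rfl

theorem removeNth_zero_vecCons {X : Type*} {n : ℕ} (x : X) (w : Fin n → X) :
    Fin.removeNth 0 (Matrix.vecCons x w) = w := rfl

theorem removeNth_succ_vecCons {X : Type*} {n : ℕ} (x : X) (w : Fin (n + 1) → X)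
    (k : Fin (n + 1)) :
    Fin.removeNth k.succ (Matrix.vecCons x w) = Matrix.vecCons x (k.removeNth w) := by
  ext i
  cases i using Fin.cases <;> simp [Fin.removeNth]

theorem map_vecCons_vecCons_smul {n : ℕ} (α : Form K R (n + 2)) (c : R) (y x : Der K R)
    (w : Fin n → Der K R) :
    α (Matrix.vecCons y (Matrix.vecCons (c • x) w)) =
      c • α (Matrix.vecCons y (Matrix.vecCons x w)) :=
  (α.curryLeft y).map_vecCons_smul w c x

theorem ceDiffFun_smul_zero : ∀ {n : ℕ} (α : Form K R n) (c : R) (x : Der K R)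
    (w : Fin n → Der K R),
    ceDiffFun α (Matrix.vecCons (c • x) w) = c • ceDiffFun α (Matrix.vecCons x w)
  | 0, α, c, x, w => by
      simp [ceDiffFun]
  | n + 1, α, c, x, w => by
      have h1 : ∀ y : Der K R, ⁅c • x, y⁆ = c • ⁅x, y⁆ - y c • x := by
        intro y
        ext r
        simp only [Derivation.commutator_apply, Derivation.sub_apply, Derivation.smul_apply,
          smul_eq_mul, Derivation.leibniz]
        ring
      have h2 : ∀ z : Fin n → Der K R, ∀ y : Der K R, y (α (Matrix.vecCons (c • x) z)) =
          c • y (α (Matrix.vecCons x z)) + y c * α (Matrix.vecCons x z) := by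
        intro z y
        rw [α.map_vecCons_smul, smul_eq_mul, Derivation.leibniz, smul_eq_mul, smul_eq_mul,
          mul_comm (y c)]
      have h3 : ∀ z : Fin n → Der K R, ∀ y : Der K R,
          α (Matrix.vecCons (c • ⁅x, y⁆ - y c • x) z) =
          c • α (Matrix.vecCons ⁅x, y⁆ z) - y c * α (Matrix.vecCons x z) := by
        intro z y
        have h := congrArg (fun f => f z) ((α.curryLeft).map_sub (c • ⁅x, y⁆) (y c • x))
        rw [map_smul, map_smul] at h
        exact h
      have h4 : ∀ i : Fin n, ∀ j ∈ Finset.Ici i.succ,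
          (-1 : ℤ) ^ (i.succ + j + 1 : ℕ) • α (Matrix.vecCons
            ⁅Matrix.vecCons (c • x) w i.succ.castSucc, Matrix.vecCons (c • x) w j.succ⁆
            (j.removeNth (i.succ.castSucc.removeNth (Matrix.vecCons (c • x) w)))) =
          c • ((-1 : ℤ) ^ (i.succ + j + 1 : ℕ) • α (Matrix.vecCons
            ⁅Matrix.vecCons x w i.succ.castSucc, Matrix.vecCons x w j.succ⁆
            (j.removeNth (i.succ.castSucc.removeNth (Matrix.vecCons x w))))) := by
        intro i j hj
        obtain ⟨m, rfl⟩ : ∃ m, n = m + 1 := ⟨n - 1, by have := i.pos; omega⟩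
        obtain ⟨j', rfl⟩ : ∃ j', j = Fin.succ j' :=
          Fin.exists_succ_eq.2 (by
            rintro rfl
            simp at hj) |>.imp fun _ h => h.symm
        rw [← Fin.succ_castSucc, removeNth_succ_vecCons, removeNth_succ_vecCons,
          removeNth_succ_vecCons, removeNth_succ_vecCons, map_vecCons_vecCons_smul, smul_comm]
        simp only [Matrix.cons_val_succ]
      refine (congrArg₂ (· + ·) (Fin.sum_univ_succ _) (Fin.sum_univ_succ _)).trans
        (Eq.trans ?_ (congrArg (c • ·)
          (congrArg₂ (· + ·) (Fin.sum_univ_succ _) (Fin.sum_univ_succ _))).symm)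
      rw [Finset.sum_congr rfl (fun i _ => Finset.sum_congr rfl (h4 i))]
      simp only [removeNth_succ_vecCons, removeNth_zero_vecCons, Matrix.cons_val_zero,
        Matrix.cons_val_succ, Fin.castSucc_zero, Fin.val_zero, Fin.val_succ, h1, h2, h3,
        smul_add, smul_sub, Finset.smul_sum, Finset.sum_add_distrib, Finset.sum_sub_distrib,
        Derivation.smul_apply, smul_comm c, show Finset.Ici (0 : Fin (n + 1)) = Finset.univ from
          Finset.Ici_bot, zero_add]
      abel

theorem ceDiffFun_update_smul {n : ℕ} (α : Form K R n) (v : Fin (n + 1) → Der K R)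
    (i : Fin (n + 1)) (c : R) (x : Der K R) :
    ceDiffFun α (Function.update v i (c • x)) = c • ceDiffFun α (Function.update v i x) := by
  rw [← Fin.insertNth_removeNth, ← Fin.insertNth_removeNth, ← auxDiff_apply, ← auxDiff_apply,
    AlternatingMap.map_insertNth, AlternatingMap.map_insertNth, auxDiff_apply, auxDiff_apply,
    ceDiffFun_smul_zero, smul_comm]

/-- The Chevalley--Eilenberg (de Rham) differential. -/
def ceDiff {n : ℕ} : Form K R n →ₗ[K] Form K R (n + 1) where
  toFun α :=
    { toFun := ceDiffFun α
      map_update_add' := by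
        intro inst v i x y
        rw [Subsingleton.elim inst (instDecidableEqFin _)]
        rw [← auxDiff_apply, ← auxDiff_apply, ← auxDiff_apply, AlternatingMap.map_update_add]
      map_update_smul' := by
        intro inst v i c x
        rw [Subsingleton.elim inst (instDecidableEqFin _)]
        exact ceDiffFun_update_smul α v i c x
      map_eq_zero_of_eq' := by
        intro v i j h hij
        rw [← auxDiff_apply]
        exact AlternatingMap.map_eq_zero_of_eq _ v h hij }
  map_add' α β := by
    ext v
    change ceDiffFun (α + β) v = ceDiffFun α v + ceDiffFun β v
    cases n with
    | zero => simp [ceDiffFun]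
    | succ n =>
      simp only [ceDiffFun, AlternatingMap.add_apply, map_add, smul_add, Finset.sum_add_distrib]
      abel
  map_smul' c α := by
    ext v
    change ceDiffFun (c • α) v = c • ceDiffFun α v
    cases n with
    | zero => simp [ceDiffFun]
    | succ n =>
      simp only [ceDiffFun, AlternatingMap.smul_apply, Derivation.map_smul, smul_add,
        Finset.smul_sum, smul_comm c]

/-- The contraction `ι_X`, insertion into the first slot; it is zero on `0`-forms. -/
def contr (X : Der K R) : ∀ {n : ℕ}, Form K R n →ₗ[R] Form K R (n - 1)
  | 0 => 0
  | _ + 1 => AlternatingMap.curryLeftLinearMap.flip X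

/-- The Lie derivative `L_X = ι_X ∘ d + d ∘ ι_X`. -/
def lieDer (X : Der K R) : ∀ {n : ℕ}, Form K R n →ₗ[K] Form K R n
  | 0 => (contr X).restrictScalars K ∘ₗ ceDiff
  | n + 1 => LinearMap.comp (M₂ := Form K R (n + 2)) ((contr X).restrictScalars K) ceDiff +
      LinearMap.comp (M₂ := Form K R n) ceDiff ((contr X).restrictScalars K)

/-- The iterated contraction `ι_{X₁} ⋯ ι_{X_j} α`. -/
def iterContr : ∀ {j m : ℕ}, (Fin j → Der K R) → Form K R (m + j) → Form K R m
  | 0, _, _, α => α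
  | j + 1, _, X, α => iterContr (Fin.init X) (contr (X (Fin.last j)) α)

/-! ### The constraint algebra `(R, R, I)` and its derivations and forms -/

/-- `𝔛(A)_W`: the derivations preserving `I`. -/
def derW (I : Ideal R) : Submodule R (Der K R) where
  carrier := {X | ∀ f ∈ I, X f ∈ I}
  add_mem' hX hY f hf := I.add_mem (hX f hf) (hY f hf)
  zero_mem' _ _ := I.zero_mem
  smul_mem' c _ hX f hf := I.mul_mem_left c (hX f hf)

/-- `𝔛(A)_0`: the derivations mapping all of `R` into `I`. -/
def derN (I : Ideal R) : Submodule R (Der K R) where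
  carrier := {X | ∀ f, X f ∈ I}
  add_mem' hX hY f := I.add_mem (hX f) (hY f)
  zero_mem' _ := I.zero_mem
  smul_mem' c _ hX f := I.mul_mem_left c (hX f)

/-- `CE^n(𝔛(A))_0`: the forms with values in `I` on derivations preserving `I`. -/
def formN (I : Ideal R) (n : ℕ) : Submodule R (Form K R n) where
  carrier := {α | ∀ v : Fin n → Der K R, (∀ i, v i ∈ derW I) → α v ∈ I}
  add_mem' hα hβ v hv := I.add_mem (hα v hv) (hβ v hv)
  zero_mem' _ _ := I.zero_mem
  smul_mem' c _ hα v hv := I.mul_mem_left c (hα v hv)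

/-- `CE^n(𝔛(A))_W`: the forms `α` such that `α(w, v₂, …, vₙ) ∈ I` whenever `w ∈ 𝔛(A)_0` and
`v₂, …, vₙ ∈ 𝔛(A)_W`. (The condition `α(v₁, …, vₙ) ∈ A_W` is void since `A_W = R`.) -/
def formW (I : Ideal R) (n : ℕ) : Submodule R (Form K R n) where
  carrier := {α | ∀ w ∈ derN (K := K) I, contr w α ∈ formN I (n - 1)}
  add_mem' hα hβ w hw := by rw [map_add]; exact add_mem (hα w hw) (hβ w hw)
  zero_mem' w _ := by rw [map_zero]; exact zero_mem _
  smul_mem' c _ hα w hw := by rw [map_smul]; exact Submodule.smul_mem _ c (hα w hw)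

/-! ### Symmetries and basic forms -/

/-- The smallest Lie--Rinehart subalgebra `𝓕` of `𝔛(R)` (an `R`-submodule closed under the Lie
bracket) containing both `F` and `𝔛(A)_0`. -/
def symLR (I : Ideal R) (F : Set (Der K R)) : Submodule R (Der K R) :=
  sInf {N | F ⊆ N ∧ derN I ≤ N ∧ ∀ X ∈ N, ∀ Y ∈ N, ⁅X, Y⁆ ∈ N}

/-- `𝔜_W = 𝓝(𝓕, 𝔛(A)_W)`, the normalizer of `𝓕` in `𝔛(A)_W`. The other two components of the
constraint Lie--Rinehart algebra `𝔜` are `𝔜_T = 𝔛(R)` and `𝔜_0 = 𝓕`. -/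
def normW (I : Ideal R) (L : Submodule R (Der K R)) : Submodule K (Der K R) where
  carrier := {X | X ∈ derW I ∧ ∀ ξ ∈ L, ⁅ξ, X⁆ ∈ L}
  add_mem' hX hY := ⟨add_mem hX.1 hY.1, fun ξ hξ => by
    rw [lie_add]; exact add_mem (hX.2 ξ hξ) (hY.2 ξ hξ)⟩
  zero_mem' := ⟨zero_mem _, fun ξ _ => by rw [lie_zero]; exact zero_mem _⟩
  smul_mem' c _ hX := ⟨(derW I).smul_of_tower_mem c hX.1, fun ξ hξ => by
    rw [lie_smul]; exact L.smul_of_tower_mem c (hX.2 ξ hξ)⟩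

/-- `B'_W` in degree `n`, for `B = CE(𝔛(A))` and `𝔜_0 = L`: the forms `α ∈ B_W` with
`ι_ξ α, L_ξ α ∈ B_0` for all `ξ ∈ L`. (The other components are `B'_T = B_T`, `B'_0 = B_0`.) -/
def basicW (I : Ideal R) (L : Submodule R (Der K R)) (n : ℕ) : Submodule K (Form K R n) where
  carrier := {α | α ∈ formW I n ∧ ∀ ξ ∈ L, contr ξ α ∈ formN I (n - 1) ∧ lieDer ξ α ∈ formN I n}
  add_mem' hα hβ := ⟨add_mem hα.1 hβ.1, fun ξ hξ => by
    rw [map_add, map_add]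
    exact ⟨add_mem (hα.2 ξ hξ).1 (hβ.2 ξ hξ).1, add_mem (hα.2 ξ hξ).2 (hβ.2 ξ hξ).2⟩⟩
  zero_mem' := ⟨zero_mem _, fun ξ _ => by
    rw [map_zero, map_zero]; exact ⟨zero_mem _, zero_mem _⟩⟩
  smul_mem' c _ hα := ⟨(formW I n).smul_of_tower_mem c hα.1, fun ξ hξ => by
    rw [LinearMap.map_smul_of_tower, map_smul]
    exact ⟨(formN I _).smul_of_tower_mem c (hα.2 ξ hξ).1,
      (formN I _).smul_of_tower_mem c (hα.2 ξ hξ).2⟩⟩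

/-! ### The observables of a closed `(k + 1)`-form, `k = p + 1` -/

variable (K R) in
/-- Tuples of forms of degrees `0, …, k - 1` together with a derivation, where `k = p + 1`. -/
abbrev Amb (p : ℕ) := (∀ m : Fin (p + 1), Form K R m) × Der K R

variable {p : ℕ}

instance : AddCommGroup (Amb K R p) := Prod.instAddCommGroup

/-- The degree `i` part: `V^(k-1+i)`, together with the derivations if `i = 0`. -/
def ambGrade (p : ℕ) (i : ℤ) : Submodule K (Amb K R p) where
  carrier := {x | (∀ m : Fin (p + 1), (m : ℤ) ≠ p + i → x.1 m = 0) ∧ (i ≠ 0 → x.2 = 0)}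
  add_mem' hx hy := ⟨fun m hm => by simp [hx.1 m hm, hy.1 m hm],
    fun hi => by simp [hx.2 hi, hy.2 hi]⟩
  zero_mem' := ⟨fun _ _ => rfl, fun _ => rfl⟩
  smul_mem' c _ hx := ⟨fun m hm => by simp [hx.1 m hm], fun hi => by simp [hx.2 hi]⟩

/-- The total space `Ham(V, ω) = V^0 ⊕ ⋯ ⊕ V^(k-2) ⊕ Ham^0(V, ω)` of observables, where
`Ham^0(V, ω) = {(α, X) ∈ V^(k-1) ⊕ 𝔛(R) | ι_X ω = - d α}`. -/
def ham (ω : Form K R (p + 2)) : Submodule K (Amb K R p) where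
  carrier := {x | (contr x.2 ω : Form K R (p + 1)) = -ceDiff (x.1 (Fin.last p))}
  add_mem' {x y} hx hy := by
    have hx' : ω.curryLeft x.2 = -ceDiff (x.1 (Fin.last p)) := hx
    have hy' : ω.curryLeft y.2 = -ceDiff (y.1 (Fin.last p)) := hy
    change ω.curryLeft (x.2 + y.2) = -ceDiff (x.1 (Fin.last p) + y.1 (Fin.last p))
    rw [map_add, map_add, hx', hy', neg_add]
  zero_mem' := by
    change ω.curryLeft 0 = -ceDiff (K := K) 0
    rw [map_zero, map_zero, neg_zero]
  smul_mem' c x hx := by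
    have hx' : ω.curryLeft x.2 = -ceDiff (x.1 (Fin.last p)) := hx
    change ω.curryLeft (c • x.2) = -ceDiff (c • x.1 (Fin.last p))
    rw [LinearMap.map_smul_of_tower, map_smul, hx', smul_neg]

/-- `Ham(B', ω)_W`: forms in `B'_W`, and Hamiltonian pairs in `B'_W ⊕ 𝔜_W`. -/
def hamW (I : Ideal R) (F : Set (Der K R)) (ω : Form K R (p + 2)) : Submodule K (Amb K R p) :=
  ham ω ⊓ (Submodule.pi Set.univ fun m : Fin (p + 1) => basicW I (symLR I F) m).prod
    (normW I (symLR I F))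

/-- `Ham(B', ω)_0`: forms in `B'_0 = B_0`, and Hamiltonian pairs in `B'_0 ⊕ 𝔜_0`. -/
def hamN (I : Ideal R) (F : Set (Der K R)) (ω : Form K R (p + 2)) : Submodule K (Amb K R p) :=
  ham ω ⊓ (Submodule.pi Set.univ fun m : Fin (p + 1) => (formN I m).restrictScalars K).prod
    ((symLR I F).restrictScalars K)

/-- The reduced space `Ham(B', ω)_W / Ham(B', ω)_0`. -/
abbrev Red (I : Ideal R) (F : Set (Der K R)) (ω : Form K R (p + 2)) :=
  ↥(hamW I F ω) ⧸ (hamN I F ω).submoduleOf (hamW I F ω)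

/-- The grading of `Ham(V, ω)`. -/
def hamGrade (ω : Form K R (p + 2)) (i : ℤ) : Submodule K (ham ω) :=
  (ambGrade p i).comap (ham ω).subtype

/-- The grading of the reduced space. -/
def redGrade (I : Ideal R) (F : Set (Der K R)) (ω : Form K R (p + 2)) (i : ℤ) :
    Submodule K (Red I F ω) :=
  ((ambGrade p i).comap (hamW I F ω).subtype).map
    ((hamN I F ω).submoduleOf (hamW I F ω)).mkQ

/-- The brackets `l_j` of the observables of `ω`:
* `l_1` is `d` on forms of degree `< k - 1` (with values `(d α, 0)` on those of degree `k - 2`),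
  and zero on Hamiltonian pairs;
* `l_2((α, X), (β, Y)) = (- ι_X ι_Y ω, [X, Y])`;
* `l_j((α₁, X₁), …, (α_j, X_j)) = (-1)^(j+1) ι_{X₁} ⋯ ι_{X_j} ω` for `j ≥ 3`, a form of degree
  `k + 1 - j` (zero if `j > k + 1`);
* `l_j` for `j ≥ 2` is zero as soon as one argument has nonzero degree. -/
def obsBracket (ω : Form K R (p + 2)) : ∀ j : ℕ, (Fin j → Amb K R p) → Amb K R p
  | 0, _ => 0
  | 1, x => (fun m => Fin.cases (motive := fun m : Fin (p + 1) => Form K R m) 0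
      (fun m' : Fin p => ceDiff ((x 0).1 m'.castSucc)) m, 0)
  | j + 2, x =>
      (fun m => if h : (m : ℕ) + (j + 2) = p + 2 then
          (-1 : ℤ) ^ (j + 3) •
            iterContr (fun i => (x i).2) (ω.domDomCongr (finCongr h.symm))
        else 0,
       if j = 0 then ⁅(x 0).2, (x 1).2⁆ else 0)

end Algebra

/-! ### `L_∞`-algebras -/

section LInfinity

/-- The sign `χ(σ; x)` with `x_{σ(1)} ∧ ⋯ ∧ x_{σ(n)} = χ(σ; x) x₁ ∧ ⋯ ∧ xₙ` for homogeneous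
elements of degrees `deg`, i.e. the signature of `σ` times the Koszul sign: every inversion
contributes `-(-1)^(|x||y|)`. -/
def skewKoszul {n : ℕ} (σ : Equiv.Perm (Fin n)) (deg : Fin n → ℤ) : ℤˣ :=
  ∏ a : Fin n, ∏ b : Fin n,
    if a < b ∧ σ b < σ a then -(Int.negOnePow (deg (σ a) * deg (σ b))) else 1

/-- The `(i, n - i)`-unshuffles: `σ(1) < ⋯ < σ(i)` and `σ(i+1) < ⋯ < σ(n)`. -/
def unshuffles (n i : ℕ) : Finset (Equiv.Perm (Fin n)) :=
  {σ | ∀ a b : Fin n, a < b → ((b : ℕ) < i ∨ i ≤ (a : ℕ)) → σ a < σ b}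

/-- An `L_∞`-algebra structure, in cohomological grading, on a vector space `V` graded by the
subspaces `𝒜 i`: multilinear brackets `l j`, `j ≥ 1`, of degree `2 - j`, which are graded skew
and satisfy, for all `n ≥ 1`,
`∑_{i+j=n+1} (-1)^(i(j-1)) ∑_σ χ(σ; x) l_j(l_i(x_{σ(1)},…,x_{σ(i)}), x_{σ(i+1)},…,x_{σ(n)}) = 0`,
where `σ` runs over the `(i, n - i)`-unshuffles. (Below, `i` is replaced by `i + 1`.) -/
structure LInfinityAlgebra (K : Type*) [Field K] {V : Type*} [AddCommGroup V] [Module K V]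
    (𝒜 : ℤ → Submodule K V) where
  isInternal : DirectSum.IsInternal 𝒜
  /-- the brackets -/
  l : ∀ n : ℕ, MultilinearMap K (fun _ : Fin n => V) V
  l_zero : l 0 = 0
  l_mem : ∀ (n : ℕ) (deg : Fin n → ℤ) (x : Fin n → V), (∀ i, x i ∈ 𝒜 (deg i)) →
    l n x ∈ 𝒜 (∑ i, deg i + 2 - n)
  skew : ∀ (n : ℕ) (deg : Fin n → ℤ) (x : Fin n → V), (∀ i, x i ∈ 𝒜 (deg i)) →
    ∀ σ : Equiv.Perm (Fin n), l n (fun i => x (σ i)) = skewKoszul σ deg • l n x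
  jacobi : ∀ (n : ℕ) (deg : Fin n → ℤ) (x : Fin n → V), (∀ i, x i ∈ 𝒜 (deg i)) →
    ∑ i : Fin n, ∑ σ ∈ unshuffles n (i + 1),
      ((-1 : ℤˣ) ^ (((i : ℕ) + 1) * (n - (i + 1))) * skewKoszul σ deg) •
        l (n - (i + 1) + 1) (Matrix.vecCons
          (l (i + 1) fun a => x (σ ⟨a, by omega⟩))
          (fun b : Fin (n - (i + 1)) => x (σ ⟨i + 1 + b, by omega⟩))) = 0

end LInfinity

/-! ### Smooth manifolds -/

section Manifold

open scoped ContDiff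

variable {n : ℕ} {M : Type*} [TopologicalSpace M] [ChartedSpace (EuclideanSpace ℝ (Fin n)) M]

variable (n M) in
/-- The algebra `C^∞(M)` of a smooth manifold of dimension `n`. Its derivations are the smooth
vector fields `𝔛(M)`, and its forms `Form ℝ C^∞(M) m` are the smooth differential forms. -/
abbrev Smooth := C^∞⟮𝓡 n, M; 𝓘(ℝ, ℝ), ℝ⟯

/-- The ideal `I_S` of smooth functions vanishing on `S`. -/
def vanishingIdeal (S : Set M) : Ideal (Smooth n M) where
  carrier := {f | ∀ x ∈ S, f x = 0}
  add_mem' hf hg x hx := by simp [hf x hx, hg x hx]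
  zero_mem' _ _ := rfl
  smul_mem' c f hf x hx := by simp [hf x hx]

end Manifold

end

end ConstraintReduction

/-!
A pair `(α, X)` in `Ham(M, ω)` satisfies `ι_X ω = -d α`, so `L_X ω = 0` when `ω` is closed.
Iterating Cartan's formula `[L_X, ι_Y] = ι_[X, Y]` then writes `d (ι_{X₁} ⋯ ι_{Xₙ} ω)` as a signed
sum over pairs of the contractions in which `X_i` and `X_j` are replaced by `[X_i, X_j]`. This is
the `n`-th Jacobi identity of the observables: brackets of three or more elements are forms, on
which all brackets but `l_1` vanish, and `l_1(α)` has no vector field component, so that only the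
unshuffles with `i = 2` and `i = n` contribute.

For the reduction, the geometric input is that `𝔛(M)` is spanned over `C^∞(M)` by finitely many
vector fields `Y_l`, with `X = ∑ l, X(h_l) Y_l` for finitely many functions `h_l`. Indeed,
countably many functions supported in charts have differentials separating the tangent vectors,
and as in Whitney's theorem more than `2 n` generic combinations of them already do; the matrix of
their differentials is then inverted through its Gram determinant. Hence a vector field mapping
`C^∞(M)` to `I_S` lies in `I_S 𝔛(M)`. Consequently `B_W` consists of all forms,
`𝓕 = C^∞(M) F + I_S 𝔛(M)`, and the conditions imposed for all `ξ ∈ 𝓕` only have to be checked for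
`ξ ∈ F`. In particular `ω` is basic, and `d`, contraction along `𝔜_W` and the Lie bracket preserve
basic forms and `𝔜_W`, so that the brackets restrict and descend.
-/

namespace ConstraintReduction

noncomputable section

/-! ### Cartan calculus -/

section Cartan

variable {K : Type*} [Field K] {R : Type*} [CommRing R] [Algebra K R] {n : ℕ}

/-- The contraction `ι_X` on forms of positive degree, with target degree `n` rather than
`n + 1 - 1` as for `contr`. -/
def ins (X : Der K R) : Form K R (n + 1) →ₗ[R] Form K R n :=
  AlternatingMap.curryLeftLinearMap.flip X

theorem contr_succ (X : Der K R) (α : Form K R (n + 1)) : contr X α = ins X α := rfl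

theorem ins_apply (X : Der K R) (α : Form K R (n + 1)) (v : Fin n → Der K R) :
    ins X α v = α (Matrix.vecCons X v) := rfl

theorem ins_add_left (X Y : Der K R) (α : Form K R (n + 1)) :
    ins (X + Y) α = ins X α + ins Y α :=
  map_add α.curryLeft X Y

theorem ins_sub_left (X Y : Der K R) (α : Form K R (n + 1)) :
    ins (X - Y) α = ins X α - ins Y α :=
  map_sub α.curryLeft X Y

theorem ins_smul_left (c : R) (X : Der K R) (α : Form K R (n + 1)) :
    ins (c • X) α = c • ins X α :=
  map_smul α.curryLeft c X

theorem ins_zero_left (α : Form K R (n + 1)) : ins (0 : Der K R) α = 0 :=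
  map_zero α.curryLeft

theorem form_ext_ins {α β : Form K R (n + 1)} (h : ∀ X : Der K R, ins X α = ins X β) :
    α = β := by
  ext v
  rw [← Fin.cons_self_tail v]
  exact DFunLike.congr_fun (h (v 0)) (Fin.tail v)

theorem ins_ins_self (X : Der K R) (α : Form K R (n + 2)) : ins X (ins X α) = 0 :=
  α.curryLeft_same X

theorem ins_ins_swap (X Y : Der K R) (α : Form K R (n + 2)) :
    ins X (ins Y α) = -ins Y (ins X α) := by
  have h := ins_ins_self (X + Y) α
  rw [ins_add_left X Y α, map_add, ins_add_left, ins_add_left, ins_ins_self, ins_ins_self,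
    zero_add, add_zero] at h
  exact eq_neg_of_add_eq_zero_right h

theorem map_vecCons_swap (α : Form K R (n + 2)) (X Y : Der K R) (v : Fin n → Der K R) :
    α (Matrix.vecCons X (Matrix.vecCons Y v)) = -α (Matrix.vecCons Y (Matrix.vecCons X v)) :=
  DFunLike.congr_fun (ins_ins_swap Y X α) v

theorem sum_Ici_succ {A : Type*} [AddCommMonoid A] (i : Fin n) (f : Fin (n + 1) → A) :
    ∑ j ∈ Finset.Ici i.succ, f j = ∑ j ∈ Finset.Ici i, f j.succ := by
  rw [← Fin.map_succEmb_Ici, Finset.sum_map]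
  rfl

theorem ceDiffFun_vecCons (α : Form K R (n + 1)) (X : Der K R) (v : Fin (n + 1) → Der K R) :
    ceDiffFun α (Matrix.vecCons X v) = X (α v) -
      (∑ i : Fin (n + 1), (-1 : ℤ) ^ (i : ℕ) • v i (ins X α (i.removeNth v))) -
      (∑ j : Fin (n + 1), (-1 : ℤ) ^ (j : ℕ) • α (Matrix.vecCons ⁅X, v j⁆ (j.removeNth v))) +
      ∑ i : Fin n, ∑ j ∈ Finset.Ici i.succ, (-1 : ℤ) ^ (i.succ + j + 1 : ℕ) • α (Matrix.vecCons
        ⁅v i.castSucc, v j⁆ (j.removeNth (i.succ.castSucc.removeNth (Matrix.vecCons X v)))) := by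
  refine (congrArg₂ (· + ·) (Fin.sum_univ_succ _) (Fin.sum_univ_succ _)).trans ?_
  simp only [removeNth_succ_vecCons, removeNth_zero_vecCons, Matrix.cons_val_zero,
    Matrix.cons_val_succ, Fin.castSucc_zero, Fin.val_zero, Fin.val_succ, pow_succ, mul_neg_one,
    neg_smul, Finset.sum_neg_distrib, pow_zero, one_smul, zero_add, ins_apply,
    ← Fin.succ_castSucc, show Finset.Ici (0 : Fin (n + 1)) = Finset.univ from Finset.Ici_bot]
  abel

theorem sum_lie_removeNth_vecCons (α : Form K R (n + 2)) (X : Der K R)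
    (v : Fin (n + 2) → Der K R) :
    ∑ i : Fin (n + 1), ∑ j ∈ Finset.Ici i.succ, (-1 : ℤ) ^ (i.succ + j + 1 : ℕ) •
        α (Matrix.vecCons ⁅v i.castSucc, v j⁆
          (j.removeNth (i.succ.castSucc.removeNth (Matrix.vecCons X v)))) =
      -∑ i : Fin (n + 1), ∑ j ∈ Finset.Ici i, (-1 : ℤ) ^ (i + j + 1 : ℕ) •
        ins X α (Matrix.vecCons ⁅v i.castSucc, v j.succ⁆
          (j.removeNth (i.castSucc.removeNth v))) := by
  simp only [← Finset.sum_neg_distrib, sum_Ici_succ, ← Fin.succ_castSucc, removeNth_succ_vecCons,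
    ins_apply, Fin.val_succ]
  refine Finset.sum_congr rfl fun i _ => Finset.sum_congr rfl fun j _ => ?_
  rw [map_vecCons_swap, smul_neg, show (i + 1 + (j + 1) + 1 : ℕ) = i + j + 1 + 2 by ring, pow_add,
    neg_one_sq, mul_one]

variable [CharZero K]

theorem ceDiff_apply (α : Form K R n) (v : Fin (n + 1) → Der K R) :
    ceDiff α v = ceDiffFun α v := rfl

theorem lieDer_zero (X : Der K R) (α : Form K R 0) : lieDer X α = ins X (ceDiff α) := rfl

theorem lieDer_succ (X : Der K R) (α : Form K R (n + 1)) :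
    lieDer X α = ins X (ceDiff α) + ceDiff (ins X α) := rfl

theorem lieDer_zero_apply (X : Der K R) (α : Form K R 0) (v : Fin 0 → Der K R) :
    lieDer X α v = X (α v) := rfl

theorem lieDer_succ_apply (X : Der K R) (α : Form K R (n + 1)) (v : Fin (n + 1) → Der K R) :
    lieDer X α v = X (α v) - ∑ j : Fin (n + 1), (-1 : ℤ) ^ (j : ℕ) •
      α (Matrix.vecCons ⁅X, v j⁆ (j.removeNth v)) := by
  rw [lieDer_succ, AlternatingMap.add_apply, ins_apply, ceDiff_apply, ceDiff_apply,
    ceDiffFun_vecCons]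
  cases n with
  | zero =>
    simp only [ceDiffFun, Fin.sum_univ_succ, Finset.univ_eq_empty, Finset.sum_empty,
      Fin.val_zero, pow_zero, one_smul]
    abel
  | succ n =>
    rw [sum_lie_removeNth_vecCons]
    simp only [ceDiffFun]
    abel

theorem lieDer_ins (X Y : Der K R) (α : Form K R (n + 1)) :
    lieDer X (ins Y α) = ins Y (lieDer X α) + ins ⁅X, Y⁆ α := by
  ext v
  rw [AlternatingMap.add_apply, ins_apply, ins_apply, lieDer_succ_apply, Fin.sum_univ_succ]
  cases n with
  | zero =>
    rw [lieDer_zero_apply]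
    simp [ins_apply]
  | succ n =>
    rw [lieDer_succ_apply]
    simp only [ins_apply, removeNth_succ_vecCons, removeNth_zero_vecCons, Matrix.cons_val_zero,
      Matrix.cons_val_succ, Fin.val_zero, Fin.val_succ, pow_succ, mul_neg_one, neg_smul,
      Finset.sum_neg_distrib, pow_zero, one_smul, map_vecCons_swap α _ Y, smul_neg]
    abel

theorem ins_lieDer (X Y : Der K R) (α : Form K R (n + 1)) :
    ins Y (lieDer X α) = lieDer X (ins Y α) - ins ⁅X, Y⁆ α := by
  rw [lieDer_ins, add_sub_cancel_right]

theorem ins_ceDiff (X : Der K R) (α : Form K R (n + 1)) :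
    ins X (ceDiff α) = lieDer X α - ceDiff (ins X α) := by
  rw [lieDer_succ, add_sub_cancel_right]

/- A form of positive degree is determined by its contractions, so each of the remaining Cartan
identities follows by induction on the degree from the commutation rule `ins_lieDer`. -/

theorem lieDer_lie (X Y : Der K R) : ∀ {n : ℕ} (α : Form K R n),
    lieDer ⁅X, Y⁆ α = lieDer X (lieDer Y α) - lieDer Y (lieDer X α)
  | 0, α => by
    ext v
    simp only [lieDer_zero_apply, AlternatingMap.sub_apply, Derivation.commutator_apply]
  | n + 1, α => by
    refine form_ext_ins fun Z => ?_
    simp only [map_sub, ins_lieDer, lieDer_lie X Y (ins Z α), lie_lie, ins_sub_left]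
    abel

theorem lieDer_ceDiff (X : Der K R) : ∀ {n : ℕ} (α : Form K R n),
    lieDer X (ceDiff α) = ceDiff (lieDer X α)
  | 0, α => by
    refine form_ext_ins fun Y => ?_
    rw [ins_lieDer, ← lieDer_zero, ← lieDer_zero, ← lieDer_zero, lieDer_lie, sub_sub_cancel]
  | n + 1, α => by
    refine form_ext_ins fun Y => ?_
    rw [ins_lieDer, ins_ceDiff, ins_ceDiff, ins_ceDiff, ins_lieDer, lieDer_lie, map_sub, map_sub,
      lieDer_ceDiff X (ins Y α)]
    abel

theorem ceDiff_ceDiff : ∀ {n : ℕ} (α : Form K R n), ceDiff (ceDiff α) = 0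
  | 0, α => by
    refine form_ext_ins fun X => ?_
    rw [ins_ceDiff, lieDer_ceDiff, ← lieDer_zero, sub_self, map_zero]
  | n + 1, α => by
    refine form_ext_ins fun X => ?_
    rw [ins_ceDiff, lieDer_ceDiff, ins_ceDiff, map_sub, ceDiff_ceDiff (ins X α), sub_zero,
      sub_self, map_zero]

end Cartan

/-! ### Iterated contractions on the total space of forms -/

section SquareZero

variable {R M T : Type*} [CommRing R] [AddCommGroup M] [Module R M] [AddCommGroup T] [Module R T]

/-- For operators `f m` of square zero on `T`, the alternating map
`(m₁, …, mₙ) ↦ f m₁ (⋯ (f mₙ t))`. -/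
def iterOp (f : M →ₗ[R] Module.End R T) (hf : ∀ m, f m * f m = 0) (t : T) (n : ℕ) :
    M [⋀^Fin n]→ₗ[R] T :=
  (LinearMap.applyₗ t ∘ₗ (ExteriorAlgebra.lift R ⟨f, hf⟩).toLinearMap).compAlternatingMap
    (ExteriorAlgebra.ιMulti R n)

theorem iterOp_zero (f : M →ₗ[R] Module.End R T) (hf : ∀ m, f m * f m = 0) (t : T)
    (v : Fin 0 → M) : iterOp f hf t 0 v = t := by
  simp [iterOp]

theorem iterOp_succ (f : M →ₗ[R] Module.End R T) (hf : ∀ m, f m * f m = 0) (t : T) {n : ℕ}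
    (v : Fin (n + 1) → M) : iterOp f hf t (n + 1) v = f (v 0) (iterOp f hf t n (Fin.tail v)) := by
  simp only [iterOp, LinearMap.compAlternatingMap_apply, LinearMap.comp_apply,
    AlgHom.toLinearMap_apply, ExteriorAlgebra.ιMulti_succ_apply, map_mul,
    ExteriorAlgebra.lift_ι_apply, LinearMap.applyₗ_apply_apply, Module.End.mul_apply]
  rfl

end SquareZero

section TotalForms

variable (K : Type*) [Field K] (R : Type*) [CommRing R] [Algebra K R]

/-- Families of forms, one in every degree. On them, contractions and differential are
endomorphisms, so that iterated contractions need no degree bookkeeping. -/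
abbrev TotalForm := ∀ n : ℕ, Form K R n

variable {K R}

/-- The contractions `ι_X` on families of forms, as a linear map in `X`. -/
def totalIns : Der K R →ₗ[R] Module.End R (TotalForm K R) where
  toFun X := LinearMap.pi fun n => ins X ∘ₗ LinearMap.proj (n + 1)
  map_add' X Y := by
    ext1 α
    exact funext fun n => ins_add_left X Y _
  map_smul' c X := by
    ext1 α
    exact funext fun n => ins_smul_left c X _

theorem totalIns_apply (X : Der K R) (α : TotalForm K R) (n : ℕ) :
    totalIns X α n = ins X (α (n + 1)) := rfl

theorem totalIns_mul_self (X : Der K R) :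
    (totalIns X * totalIns X : Module.End R (TotalForm K R)) = 0 := by
  ext1 α
  exact funext fun n => ins_ins_self X (α (n + 2))

theorem totalIns_totalIns_swap (X Y : Der K R) (α : TotalForm K R) :
    totalIns X (totalIns Y α) = -totalIns Y (totalIns X α) :=
  funext fun n => ins_ins_swap X Y (α (n + 2))

theorem totalIns_single (X : Der K R) {N : ℕ} (ω : Form K R (N + 1)) :
    totalIns X (Pi.single (N + 1) ω) = Pi.single N (ins X ω) := by
  funext m
  rw [totalIns_apply]
  rcases eq_or_ne m N with rfl | h
  · rw [Pi.single_eq_same, Pi.single_eq_same]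
  · rw [Pi.single_eq_of_ne h, Pi.single_eq_of_ne (by omega), map_zero]

/-- `(X₁, …, Xₙ) ↦ ι_{X₁} ⋯ ι_{Xₙ} α`, as an alternating map. -/
def multiIns (α : TotalForm K R) (n : ℕ) : (Der K R) [⋀^Fin n]→ₗ[R] TotalForm K R :=
  iterOp totalIns totalIns_mul_self α n

theorem multiIns_zero (α : TotalForm K R) (X : Fin 0 → Der K R) : multiIns α 0 X = α :=
  iterOp_zero _ _ _ _

theorem multiIns_succ (α : TotalForm K R) {n : ℕ} (X : Fin (n + 1) → Der K R) :
    multiIns α (n + 1) X = totalIns (X 0) (multiIns α n (Fin.tail X)) :=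
  iterOp_succ _ _ _ _

theorem multiIns_vecCons (α : TotalForm K R) {n : ℕ} (Y : Der K R) (X : Fin n → Der K R) :
    multiIns α (n + 1) (Matrix.vecCons Y X) = totalIns Y (multiIns α n X) :=
  multiIns_succ α _

theorem multiIns_vecCons_vecCons_swap (α : TotalForm K R) {n : ℕ} (Y Z : Der K R)
    (X : Fin n → Der K R) :
    multiIns α (n + 2) (Matrix.vecCons Y (Matrix.vecCons Z X)) =
      -totalIns Z (multiIns α (n + 1) (Matrix.vecCons Y X)) := by
  rw [multiIns_vecCons, multiIns_vecCons, multiIns_vecCons, totalIns_totalIns_swap]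

theorem multiIns_eq_multiIns_init (α : TotalForm K R) : ∀ {n : ℕ} (X : Fin (n + 1) → Der K R),
    multiIns α (n + 1) X = multiIns (totalIns (X (Fin.last n)) α) n (Fin.init X)
  | 0, X => by
    rw [multiIns_zero, multiIns_succ, multiIns_zero]
    rfl
  | n + 1, X => by
    rw [multiIns_succ, multiIns_eq_multiIns_init α (Fin.tail X), multiIns_succ]
    rfl

theorem multiIns_single_of_ne {N : ℕ} (ω : Form K R N) : ∀ {n : ℕ} (X : Fin n → Der K R) {m : ℕ},
    m + n ≠ N → multiIns (Pi.single N ω) n X m = 0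
  | 0, X, m, h => by
    rw [multiIns_zero]
    exact Pi.single_eq_of_ne h ω
  | n + 1, X, m, h => by
    rw [multiIns_succ, totalIns_apply, multiIns_single_of_ne ω _ (by omega), map_zero]

theorem multiIns_single_eq_iterContr : ∀ {n m : ℕ} (X : Fin n → Der K R) (ω : Form K R (m + n)),
    multiIns (Pi.single (m + n) ω) n X m = iterContr X ω
  | 0, m, X, ω => by
    rw [multiIns_zero]
    exact Pi.single_eq_same m ω
  | n + 1, m, X, ω => by
    rw [multiIns_eq_multiIns_init]
    refine Eq.trans ?_ (multiIns_single_eq_iterContr (Fin.init X) (ins (X (Fin.last n)) ω))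
    rw [← totalIns_single]
    rfl

theorem single_domDomCongr {N N' : ℕ} (h : N = N') (ω : Form K R N) :
    (Pi.single N' (ω.domDomCongr (finCongr h)) : TotalForm K R) = Pi.single N ω := by
  subst h
  rfl

variable [CharZero K]

/-- The Chevalley-Eilenberg differential on families of forms. -/
def totalDiff : TotalForm K R →ₗ[K] TotalForm K R :=
  LinearMap.pi fun
    | 0 => 0
    | n + 1 => ceDiff ∘ₗ LinearMap.proj n

theorem totalDiff_succ (α : TotalForm K R) (n : ℕ) : totalDiff α (n + 1) = ceDiff (α n) := rfl

/-- The Lie derivative on families of forms. -/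
def totalLie (X : Der K R) : TotalForm K R →ₗ[K] TotalForm K R :=
  LinearMap.pi fun n => lieDer X ∘ₗ LinearMap.proj n

theorem totalDiff_single {N : ℕ} {ω : Form K R N} (hω : ceDiff ω = 0) :
    totalDiff (Pi.single N ω) = 0 := by
  funext m
  cases m with
  | zero => rfl
  | succ m =>
    rw [totalDiff_succ]
    rcases eq_or_ne m N with rfl | hm
    · rw [Pi.single_eq_same, hω, Pi.zero_apply]
    · rw [Pi.single_eq_of_ne hm, map_zero, Pi.zero_apply]

theorem totalLie_single {N : ℕ} {ω : Form K R N} {X : Der K R} (hX : lieDer X ω = 0) :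
    totalLie X (Pi.single N ω) = 0 := by
  funext m
  rcases eq_or_ne m N with rfl | hm
  · exact (congrArg (lieDer X) (Pi.single_eq_same m ω)).trans hX
  · exact (congrArg (lieDer X) (Pi.single_eq_of_ne hm ω)).trans (map_zero _)

theorem totalDiff_totalIns (X : Der K R) (α : TotalForm K R) :
    totalDiff (totalIns X α) = totalLie X α - totalIns X (totalDiff α) := by
  funext n
  rw [Pi.sub_apply, eq_sub_iff_add_eq]
  cases n with
  | zero => exact zero_add _
  | succ n => exact add_comm _ _

theorem totalLie_totalIns (X Y : Der K R) (α : TotalForm K R) :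
    totalLie X (totalIns Y α) = totalIns Y (totalLie X α) + totalIns ⁅X, Y⁆ α :=
  funext fun n => lieDer_ins X Y (α (n + 1))

theorem totalLie_multiIns {ω : TotalForm K R} (Y : Der K R) (hω : totalLie Y ω = 0) :
    ∀ {n : ℕ} (X : Fin (n + 1) → Der K R), totalLie Y (multiIns ω (n + 1) X) =
      ∑ j : Fin (n + 1), (-1 : ℤ) ^ (j : ℕ) •
        multiIns ω (n + 1) (Matrix.vecCons ⁅Y, X j⁆ (j.removeNth X))
  | 0, X => by
    simp [multiIns_succ, multiIns_zero, totalLie_totalIns, hω]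
  | n + 1, X => by
    obtain ⟨Z, X, rfl⟩ : ∃ Z X', X = Matrix.vecCons Z X' :=
      ⟨X 0, Fin.tail X, (Fin.cons_self_tail X).symm⟩
    rw [Fin.sum_univ_succ, multiIns_vecCons, totalLie_totalIns, totalLie_multiIns Y hω X]
    simp only [removeNth_succ_vecCons, removeNth_zero_vecCons, Matrix.cons_val_zero,
      Matrix.cons_val_succ, Fin.val_zero, Fin.val_succ, pow_succ, mul_neg_one, neg_smul,
      pow_zero, one_smul, multiIns_vecCons_vecCons_swap, smul_neg, neg_neg, map_sum, map_zsmul]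
    rw [← multiIns_vecCons, add_comm]

/- By Cartan's formula, moving `d` past `ι_{X₁}` costs `L_{X₁}`, whose action on the remaining
contractions produces the brackets of `X₁` with `X₂, …, Xₙ`. -/
theorem totalDiff_multiIns {ω : TotalForm K R} (hω : totalDiff ω = 0) :
    ∀ {n : ℕ} (X : Fin (n + 2) → Der K R), (∀ i, totalLie (X i) ω = 0) →
      totalDiff (multiIns ω (n + 2) X) =
      ∑ i : Fin (n + 1), ∑ j ∈ Finset.Ici i, (-1 : ℤ) ^ (i + j : ℕ) • multiIns ω (n + 1)
        (Matrix.vecCons ⁅X i.castSucc, X j.succ⁆ (j.removeNth (i.castSucc.removeNth X)))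
  | 0, X, hX => by
    simp [multiIns_succ, multiIns_zero, totalDiff_totalIns, totalLie_totalIns, hω, hX, Fin.tail]
  | n + 1, X, hX => by
    obtain ⟨Z, X, rfl⟩ : ∃ Z X', X = Matrix.vecCons Z X' :=
      ⟨X 0, Fin.tail X, (Fin.cons_self_tail X).symm⟩
    have hsign (i j : ℕ) : (-1 : ℤ) ^ (i + 1 + (j + 1)) = (-1) ^ (i + j) := by ring
    rw [Fin.sum_univ_succ, multiIns_vecCons, totalDiff_totalIns, totalLie_multiIns Z (hX 0) X,
      totalDiff_multiIns hω X (fun i => hX i.succ)]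
    simp only [sum_Ici_succ, ← Fin.succ_castSucc, removeNth_succ_vecCons, removeNth_zero_vecCons,
      Matrix.cons_val_zero, Fin.castSucc_zero, Matrix.cons_val_succ, Fin.val_zero, Fin.val_succ,
      multiIns_vecCons_vecCons_swap, smul_neg, map_sum, map_zsmul, zero_add,
      Finset.sum_neg_distrib, sub_eq_add_neg, hsign,
      show Finset.Ici (0 : Fin (n + 2)) = Finset.univ from Finset.Ici_bot]

end TotalForms

/-! ### Signs and unshuffles -/

section Unshuffles

variable {n : ℕ}

theorem skewKoszul_eq_sign (σ : Equiv.Perm (Fin n)) {deg : Fin n → ℤ} (hdeg : ∀ i, deg i = 0) :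
    skewKoszul σ deg = Equiv.Perm.sign σ := by
  rw [Equiv.Perm.sign_eq_prod_prod_Ioi]
  refine Finset.prod_congr rfl fun a _ => ?_
  rw [← Finset.filter_lt_eq_Ioi, Finset.prod_filter]
  refine Finset.prod_congr rfl fun b _ => ?_
  rw [ite_and]
  refine if_ctx_congr Iff.rfl (fun hab => ?_) fun _ => rfl
  rw [hdeg, zero_mul, Int.negOnePow_zero, ← ite_not]
  exact if_congr (not_lt.trans (σ.injective.ne hab.ne).le_iff_lt) rfl rfl

theorem skewKoszul_one (deg : Fin n → ℤ) : skewKoszul 1 deg = 1 :=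
  Finset.prod_eq_one fun _ _ => Finset.prod_eq_one fun _ _ => if_neg fun h => lt_asymm h.1 h.2

theorem mem_unshuffles {i : ℕ} {σ : Equiv.Perm (Fin n)} :
    σ ∈ unshuffles n i ↔
      ∀ a b : Fin n, a < b → ((b : ℕ) < i ∨ i ≤ (a : ℕ)) → σ a < σ b := by
  simp only [unshuffles, Finset.mem_filter, Finset.mem_univ, true_and]

theorem unshuffles_self (n : ℕ) : unshuffles n n = {1} := by
  ext σ
  rw [mem_unshuffles, Finset.mem_singleton]
  constructor
  · intro h
    have hσ : StrictMono σ := fun a b hab => h a b hab (Or.inl b.2)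
    have hid : ⇑σ = id :=
      (hσ.range_inj strictMono_id).1 (by rw [σ.surjective.range_eq, Set.range_id])
    exact Equiv.coe_inj.1 hid
  · rintro rfl a b hab _
    exact hab

/-- The unshuffle of `Fin (n + 2)` that moves `i.castSucc` and `j.succ`, for `i ≤ j`, to the
front. These pairs parametrize the summands of `ceDiffFun`. -/
def pairPerm (i j : Fin (n + 1)) : Equiv.Perm (Fin (n + 2)) :=
  i.castSucc.cycleRange.symm * Equiv.Perm.decomposeFin.symm (0, j.cycleRange.symm)

theorem sign_pairPerm (i j : Fin (n + 1)) :
    Equiv.Perm.sign (pairPerm i j) = (-1) ^ (i + j : ℕ) := by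
  rw [pairPerm, Equiv.Perm.sign_mul, Equiv.Perm.decomposeFin.symm_sign, Equiv.Perm.sign_symm,
    Equiv.Perm.sign_symm, Fin.sign_cycleRange, Fin.sign_cycleRange, if_pos rfl, one_mul, pow_add,
    Fin.val_castSucc]

theorem pairPerm_zero (i j : Fin (n + 1)) : pairPerm i j 0 = i.castSucc := by
  simp [pairPerm]

theorem pairPerm_one {i j : Fin (n + 1)} (h : i ≤ j) : pairPerm i j 1 = j.succ := by
  rw [show (1 : Fin (n + 2)) = Fin.succ 0 from rfl]
  simp only [pairPerm, Equiv.Perm.mul_apply, Equiv.Perm.decomposeFin_symm_apply_succ,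
    Fin.cycleRange_symm_zero, Equiv.swap_self, Equiv.refl_apply, Fin.cycleRange_symm_succ]
  exact Fin.succAbove_of_le_castSucc _ _ (Fin.castSucc_le_castSucc_iff.2 h)

theorem pairPerm_succ_succ (i j : Fin (n + 1)) (k : Fin n) :
    pairPerm i j k.succ.succ = i.castSucc.succAbove (j.succAbove k) := by
  simp only [pairPerm, Equiv.Perm.mul_apply, Equiv.Perm.decomposeFin_symm_apply_succ,
    Equiv.swap_self, Equiv.refl_apply, Fin.cycleRange_symm_succ]

theorem exists_succ_succ_eq {c : Fin (n + 2)} (hc : 2 ≤ (c : ℕ)) : ∃ k : Fin n, k.succ.succ = c :=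
  ⟨⟨c - 2, by omega⟩, Fin.ext (by simp only [Fin.val_succ]; omega)⟩

theorem pairPerm_mem_unshuffles {i j : Fin (n + 1)} (h : i ≤ j) :
    pairPerm i j ∈ unshuffles (n + 2) 2 := by
  rw [mem_unshuffles]
  rintro a b hab (hb | ha)
  · have hab' := Fin.lt_def.1 hab
    obtain rfl : b = 1 := Fin.ext ((show (b : ℕ) = 1 by omega).trans (Fin.val_one n).symm)
    obtain rfl : a = 0 := Fin.ext (show (a : ℕ) = 0 by omega)
    rw [pairPerm_zero, pairPerm_one h]
    exact lt_of_le_of_lt (Fin.castSucc_le_castSucc_iff.2 h) Fin.castSucc_lt_succ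
  · obtain ⟨a, rfl⟩ := exists_succ_succ_eq ha
    obtain ⟨b, rfl⟩ := exists_succ_succ_eq (ha.trans (Fin.lt_def.1 hab).le)
    rw [pairPerm_succ_succ, pairPerm_succ_succ]
    exact Fin.strictMono_succAbove _ (Fin.strictMono_succAbove _ (by simpa using hab))

theorem range_perm_succ_succ (σ : Equiv.Perm (Fin (n + 2))) :
    Set.range (fun k : Fin n => σ k.succ.succ) = {σ 0, σ 1}ᶜ := by
  have hrange : Set.range (fun k : Fin n => k.succ.succ) = {0, 1}ᶜ := by
    ext c
    refine ⟨?_, fun hc => exists_succ_succ_eq ?_⟩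
    · rintro ⟨k, rfl⟩
      simp [Fin.ext_iff]
    · simp only [Set.mem_compl_iff, Set.mem_insert_iff, Set.mem_singleton_iff, Fin.ext_iff,
        Fin.val_zero, Fin.val_one] at hc
      omega
  rw [show (fun k : Fin n => σ k.succ.succ) = σ ∘ fun k => k.succ.succ from rfl, Set.range_comp,
    hrange, Set.image_compl_eq σ.bijective, Set.image_pair]

theorem unshuffles_ext {σ τ : Equiv.Perm (Fin (n + 2))} (hσ : σ ∈ unshuffles (n + 2) 2)
    (hτ : τ ∈ unshuffles (n + 2) 2) (h0 : σ 0 = τ 0) (h1 : σ 1 = τ 1) : σ = τ := by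
  have hmono {ρ : Equiv.Perm (Fin (n + 2))} (hρ : ρ ∈ unshuffles (n + 2) 2) :
      StrictMono fun k : Fin n => ρ k.succ.succ :=
    fun a b hab => mem_unshuffles.1 hρ _ _ (by simpa using hab) (Or.inr (by simp))
  have htail : (fun k : Fin n => σ k.succ.succ) = fun k => τ k.succ.succ :=
    ((hmono hσ).range_inj (hmono hτ)).1 (by
      rw [range_perm_succ_succ, range_perm_succ_succ, h0, h1])
  ext1 c
  cases c using Fin.cases with
  | zero => exact h0
  | succ c =>
    cases c using Fin.cases with
    | zero => exact h1
    | succ c => exact congrFun htail c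

theorem exists_pairPerm_eq {σ : Equiv.Perm (Fin (n + 2))} (hσ : σ ∈ unshuffles (n + 2) 2) :
    ∃ i j : Fin (n + 1), i ≤ j ∧ pairPerm i j = σ := by
  have hlt : σ 0 < σ 1 := mem_unshuffles.1 hσ 0 1 (by simp) (Or.inl (by simp))
  have h0 : σ 0 ≠ Fin.last (n + 1) := (hlt.trans_le (Fin.le_last _)).ne
  have h1 : σ 1 ≠ 0 := ((Fin.zero_le _).trans_lt hlt).ne'
  have hle : (σ 0).castPred h0 ≤ (σ 1).pred h1 := by
    rw [← Fin.castSucc_lt_succ_iff, Fin.castSucc_castPred, Fin.succ_pred]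
    exact hlt
  refine ⟨_, _, hle, unshuffles_ext (pairPerm_mem_unshuffles hle) hσ ?_ ?_⟩
  · rw [pairPerm_zero, Fin.castSucc_castPred]
  · rw [pairPerm_one hle, Fin.succ_pred]

theorem sum_unshuffles_two {A : Type*} [AddCommMonoid A] (f : Equiv.Perm (Fin (n + 2)) → A) :
    ∑ σ ∈ unshuffles (n + 2) 2, f σ =
      ∑ i : Fin (n + 1), ∑ j ∈ Finset.Ici i, f (pairPerm i j) := by
  rw [Finset.sum_sigma']
  symm
  refine Finset.sum_bij (fun x _ => pairPerm x.1 x.2) ?_ ?_ ?_ fun _ _ => rfl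
  · rintro ⟨i, j⟩ h
    exact pairPerm_mem_unshuffles (by simpa using h)
  · rintro ⟨i, j⟩ h ⟨i', j'⟩ h' heq
    simp only [Finset.mem_sigma, Finset.mem_univ, Finset.mem_Ici, true_and] at h h'
    have hi := DFunLike.congr_fun heq 0
    have hj := DFunLike.congr_fun heq 1
    simp only [pairPerm_zero, pairPerm_one h, pairPerm_one h', Fin.castSucc_inj,
      Fin.succ_inj] at hi hj
    rw [hi, hj]
  · intro σ hσ
    obtain ⟨i, j, hij, rfl⟩ := exists_pairPerm_eq hσ
    exact ⟨⟨i, j⟩, by simpa using hij, rfl⟩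

end Unshuffles

/-! ### Graded submodules and quotients -/

section Graded

variable {R V ι : Type*} [Ring R] [AddCommGroup V] [Module R V]

/-- `N` is a graded submodule of a module graded by `𝒜`: it is generated by its homogeneous
elements. -/
def IsGradedSubmodule (𝒜 : ι → Submodule R V) (N : Submodule R V) : Prop :=
  N ≤ ⨆ i, N ⊓ 𝒜 i

theorem map_subtype_submoduleOf {N W : Submodule R V} (hNW : N ≤ W) :
    (N.submoduleOf W).map W.subtype = N := by
  rw [Submodule.submoduleOf, Submodule.map_comap_subtype, inf_eq_right.2 hNW]

theorem IsGradedSubmodule.submoduleOf {𝒜 : ι → Submodule R V} {N W : Submodule R V}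
    (hN : IsGradedSubmodule 𝒜 N) (hNW : N ≤ W) :
    IsGradedSubmodule (fun i => (𝒜 i).comap W.subtype) (N.submoduleOf W) := by
  have hmap (i : ι) :
      (N.submoduleOf W ⊓ (𝒜 i).comap W.subtype).map W.subtype = N ⊓ 𝒜 i := by
    rw [Submodule.map_inf _ W.injective_subtype, map_subtype_submoduleOf hNW,
      Submodule.map_comap_subtype, ← inf_assoc, inf_eq_left.2 hNW]
  rw [IsGradedSubmodule, ← Submodule.map_le_map_iff_of_injective W.injective_subtype,
    map_subtype_submoduleOf hNW, Submodule.map_iSup]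
  simp only [hmap]
  exact hN

variable [DecidableEq ι] {𝒜 : ι → Submodule R V}

theorem IsGradedSubmodule.isInternal_comap_subtype (h𝒜 : DirectSum.IsInternal 𝒜)
    {W : Submodule R V} (hW : IsGradedSubmodule 𝒜 W) :
    DirectSum.IsInternal fun i => (𝒜 i).comap W.subtype := by
  rw [DirectSum.isInternal_submodule_iff_iSupIndep_and_iSup_eq_top] at h𝒜 ⊢
  constructor
  · intro i
    rw [Submodule.disjoint_def]
    intro x hx hx'
    have hle : (⨆ (j) (_ : j ≠ i), (𝒜 j).comap W.subtype) ≤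
        (⨆ (j) (_ : j ≠ i), 𝒜 j).comap W.subtype :=
      iSup₂_le fun j hj => Submodule.comap_mono (le_iSup₂_of_le j hj le_rfl)
    exact Subtype.ext (Submodule.disjoint_def.1 (h𝒜.1 i) x hx (hle hx'))
  · refine Submodule.map_injective_of_injective W.injective_subtype ?_
    simp only [Submodule.map_iSup, Submodule.map_comap_subtype, Submodule.map_top,
      Submodule.range_subtype]
    exact le_antisymm (iSup_le fun i => inf_le_left) hW

theorem IsGradedSubmodule.isInternal_map_mkQ (h𝒜 : DirectSum.IsInternal 𝒜)
    {N : Submodule R V} (hN : IsGradedSubmodule 𝒜 N) :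
    DirectSum.IsInternal fun i => (𝒜 i).map N.mkQ := by
  rw [DirectSum.isInternal_submodule_iff_iSupIndep_and_iSup_eq_top] at h𝒜 ⊢
  constructor
  · intro i
    rw [Submodule.disjoint_def]
    simp only [← Submodule.map_iSup]
    rintro _ ⟨x, hx, rfl⟩ ⟨y, hy, hyx⟩
    have hxy : x - y ∈ (N ⊓ 𝒜 i) ⊔ ⨆ (j) (_ : j ≠ i), N ⊓ 𝒜 j := by
      rw [← iSup_split_single (fun j => N ⊓ 𝒜 j) i]
      exact hN ((Submodule.Quotient.eq N).1 hyx.symm)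
    obtain ⟨a, ha, b, hb, hab⟩ := Submodule.mem_sup.1 hxy
    have hle : (⨆ (j) (_ : j ≠ i), N ⊓ 𝒜 j) ≤ ⨆ (j) (_ : j ≠ i), 𝒜 j :=
      iSup₂_mono fun _ _ => inf_le_right
    have hxa : x - a = y + b := by rw [sub_eq_iff_eq_add, add_assoc, add_comm b, hab]; abel
    have hzero : x - a = 0 :=
      Submodule.disjoint_def.1 (h𝒜.1 i) _ (sub_mem hx ha.2) (hxa ▸ add_mem hy (hle hb))
    rw [Submodule.mkQ_apply, Submodule.Quotient.mk_eq_zero, sub_eq_zero.1 hzero]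
    exact ha.1
  · rw [← Submodule.map_iSup, h𝒜.2, Submodule.map_top, Submodule.range_mkQ]

end Graded

section MultilinearQuotient

variable {R ι : Type*} [Ring R] [Finite ι] {M : ι → Type*} {M' : Type*}
  [∀ i, AddCommGroup (M i)] [∀ i, Module R (M i)] [AddCommGroup M'] [Module R M']
  (N : ∀ i, Submodule R (M i)) (P : Submodule R M') (f : MultilinearMap R M M')
  (hf : ∀ x i, x i ∈ N i → f x ∈ P)

include hf in
theorem mkQ_multilinearMap_eq {x y : ∀ i, M i}
    (hxy : ∀ i, (N i).mkQ (x i) = (N i).mkQ (y i)) : P.mkQ (f x) = P.mkQ (f y) := by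
  let _ : Fintype ι := Fintype.ofFinite ι
  let _ : LinearOrder ι := LinearOrder.lift' _ (Fintype.equivFin ι).injective
  refine (Submodule.Quotient.eq P).2 ?_
  have h := f.map_sub_map_piecewise x y Finset.univ
  rw [Finset.piecewise_univ] at h
  rw [h]
  refine P.sum_mem fun i _ => hf _ i ?_
  simpa using (Submodule.Quotient.eq (N i)).1 (hxy i)

include hf in
theorem mkQ_multilinearMap_surjInv_update [DecidableEq ι] (x : ∀ i, M i ⧸ N i) (i : ι) (a : M i) :
    P.mkQ (f fun j => Function.surjInv (N j).mkQ_surjective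
      (Function.update x i ((N i).mkQ a) j)) =
    P.mkQ (f (Function.update (fun j => Function.surjInv (N j).mkQ_surjective (x j)) i a)) := by
  refine mkQ_multilinearMap_eq N P f hf fun j => ?_
  rw [Function.surjInv_eq (N j).mkQ_surjective]
  rcases eq_or_ne j i with rfl | h
  · rw [Function.update_self, Function.update_self]
  · rw [Function.update_of_ne h, Function.update_of_ne h, Function.surjInv_eq (N j).mkQ_surjective]

/-- The multilinear map induced on quotients by a multilinear map `f` that takes values in `P`
as soon as its `i`-th argument lies in `N i` for some `i`. -/
def quotientMultilinearMap : MultilinearMap R (fun i => M i ⧸ N i) (M' ⧸ P) where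
  toFun x := P.mkQ (f fun i => Function.surjInv (N i).mkQ_surjective (x i))
  map_update_add' x i a b := by
    obtain ⟨a, rfl⟩ := (N i).mkQ_surjective a
    obtain ⟨b, rfl⟩ := (N i).mkQ_surjective b
    rw [← map_add]
    simp only [mkQ_multilinearMap_surjInv_update N P f hf]
    rw [f.map_update_add, map_add]
  map_update_smul' x i c a := by
    obtain ⟨a, rfl⟩ := (N i).mkQ_surjective a
    rw [← map_smul]
    simp only [mkQ_multilinearMap_surjInv_update N P f hf]
    rw [f.map_update_smul, map_smul]

theorem quotientMultilinearMap_mkQ (x : ∀ i, M i) :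
    quotientMultilinearMap N P f hf (fun i => (N i).mkQ (x i)) = P.mkQ (f x) :=
  mkQ_multilinearMap_eq N P f hf fun _ => Function.surjInv_eq _ _

end MultilinearQuotient

/-- The quotient of an `L_∞`-algebra by an ideal, i.e. a graded subspace that contains each
bracket having an argument in it. -/
def LInfinityAlgebra.quotient {K V : Type*} [Field K] [AddCommGroup V] [Module K V]
    {𝒜 : ℤ → Submodule K V} (Λ : LInfinityAlgebra K 𝒜) {N : Submodule K V}
    (hN : IsGradedSubmodule 𝒜 N) (hl : ∀ (n : ℕ) x i, x i ∈ N → Λ.l n x ∈ N) :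
    LInfinityAlgebra K fun i => (𝒜 i).map N.mkQ where
  isInternal := hN.isInternal_map_mkQ Λ.isInternal
  l n := quotientMultilinearMap (fun _ => N) N (Λ.l n) (hl n)
  l_zero := by
    ext x
    obtain rfl : x = fun _ => N.mkQ 0 := Subsingleton.elim _ _
    rw [quotientMultilinearMap_mkQ (fun _ => N), Λ.l_zero]
    rfl
  l_mem n deg x hx := by
    choose y hy hyx using hx
    obtain rfl : (fun i => N.mkQ (y i)) = x := funext hyx
    rw [quotientMultilinearMap_mkQ (fun _ => N)]
    exact ⟨_, Λ.l_mem n deg y hy, rfl⟩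
  skew n deg x hx σ := by
    choose y hy hyx using hx
    obtain rfl : (fun i => N.mkQ (y i)) = x := funext hyx
    rw [quotientMultilinearMap_mkQ (fun _ => N) N _ _ fun i => y (σ i),
      quotientMultilinearMap_mkQ (fun _ => N), Λ.skew n deg y hy]
    exact map_zsmul _ _ _
  jacobi n deg x hx := by
    choose y hy hyx using hx
    obtain rfl : (fun i => N.mkQ (y i)) = x := funext hyx
    refine Eq.trans ?_ ((congrArg N.mkQ (Λ.jacobi n deg y hy)).trans (map_zero _))
    rw [map_sum]
    refine Finset.sum_congr rfl fun i _ => ?_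
    rw [map_sum]
    refine Finset.sum_congr rfl fun σ _ => ?_
    refine Eq.trans ?_ (map_zsmul N.mkQ _ _).symm
    rw [quotientMultilinearMap_mkQ (fun _ => N) N _ _ fun a : Fin (i + 1) => y (σ ⟨a, by omega⟩)]
    congr 1
    refine Eq.trans (congrArg (quotientMultilinearMap (fun _ => N) N _ (hl _)) ?_)
      (quotientMultilinearMap_mkQ (fun _ => N) N _ (hl _) _)
    funext b
    exact Fin.cases rfl (fun _ => rfl) b

/-! ### The grading of the observables -/

section Grading

variable {K : Type*} [Field K] {R : Type*} [CommRing R] [Algebra K R] {p : ℕ}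

/-- The projection of the ambient space of observables to its part of degree `i`. -/
def ambProj (p : ℕ) (i : ℤ) : Amb K R p →ₗ[K] Amb K R p :=
  (LinearMap.pi fun m : Fin (p + 1) => if (m : ℤ) = p + i then
      LinearMap.proj m ∘ₗ LinearMap.fst K (∀ m : Fin (p + 1), Form K R m) (Der K R) else 0).prod
    (if i = 0 then LinearMap.snd K (∀ m : Fin (p + 1), Form K R m) (Der K R) else 0)

theorem ambProj_fst (i : ℤ) (x : Amb K R p) (m : Fin (p + 1)) :
    (ambProj p i x).1 m = if (m : ℤ) = p + i then x.1 m else 0 := by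
  change (if (m : ℤ) = p + i then _ else 0 : Amb K R p →ₗ[K] Form K R m) x = _
  split_ifs <;> rfl

theorem ambProj_snd (i : ℤ) (x : Amb K R p) : (ambProj p i x).2 = if i = 0 then x.2 else 0 := by
  change (if i = 0 then _ else 0 : Amb K R p →ₗ[K] Der K R) x = _
  split_ifs <;> rfl

theorem ambProj_mem_ambGrade (i : ℤ) (x : Amb K R p) : ambProj p i x ∈ ambGrade (K := K) p i :=
  ⟨fun m hm => (ambProj_fst i x m).trans (if_neg hm),
    fun hi => (ambProj_snd i x).trans (if_neg hi)⟩

theorem ambProj_of_mem {i : ℤ} {x : Amb K R p} (hx : x ∈ ambGrade (K := K) p i) :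
    ambProj p i x = x := by
  refine Prod.ext (funext fun m => ?_) ?_
  · rw [ambProj_fst]
    exact ite_eq_left_iff.2 fun h => (hx.1 m h).symm
  · rw [ambProj_snd]
    exact ite_eq_left_iff.2 fun h => (hx.2 h).symm

theorem ambGrade_le_ker_ambProj {i j : ℤ} (hij : i ≠ j) :
    ambGrade p j ≤ LinearMap.ker (ambProj (K := K) (R := R) p i) := by
  intro x hx
  refine Prod.ext (funext fun m => ?_) ?_
  · rw [ambProj_fst]
    exact ite_eq_right_iff.2 fun h => hx.1 m (by omega)
  · rw [ambProj_snd]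
    exact ite_eq_right_iff.2 fun h => hx.2 (by omega)

theorem sum_ambProj (x : Amb K R p) : ∑ i ∈ Finset.Icc (-(p : ℤ)) 0, ambProj p i x = x := by
  refine Prod.ext (funext fun m => ?_) ?_
  · have hm : (m : ℤ) - p ∈ Finset.Icc (-(p : ℤ)) 0 := by
      have := m.2
      rw [Finset.mem_Icc]
      omega
    rw [Prod.fst_sum, Finset.sum_apply, Finset.sum_eq_single_of_mem _ hm, ambProj_fst,
      if_pos (by ring)]
    intro i _ hi
    rw [ambProj_fst, if_neg (by omega)]
  · rw [Prod.snd_sum, Finset.sum_eq_single_of_mem 0 (by simp), ambProj_snd, if_pos rfl]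
    intro i _ hi
    rw [ambProj_snd, if_neg hi]

theorem isGradedSubmodule_ambGrade {N : Submodule K (Amb K R p)}
    (hN : ∀ i, ∀ x ∈ N, ambProj p i x ∈ N) : IsGradedSubmodule (ambGrade p) N := by
  intro x hx
  rw [← sum_ambProj x]
  exact sum_mem fun i _ => Submodule.mem_iSup_of_mem i ⟨hN i x hx, ambProj_mem_ambGrade i x⟩

theorem isInternal_ambGrade : DirectSum.IsInternal (ambGrade (K := K) (R := R) p) := by
  rw [DirectSum.isInternal_submodule_iff_iSupIndep_and_iSup_eq_top]
  constructor
  · intro i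
    rw [Submodule.disjoint_def]
    intro x hx hx'
    have hker : (⨆ (j) (_ : j ≠ i), ambGrade p j) ≤ LinearMap.ker (ambProj (K := K) (R := R) p i) :=
      iSup₂_le fun j hj => ambGrade_le_ker_ambProj hj.symm
    rw [← ambProj_of_mem hx]
    exact hker hx'
  · have htop : IsGradedSubmodule (ambGrade (K := K) (R := R) p) ⊤ :=
      isGradedSubmodule_ambGrade fun _ _ _ => trivial
    exact top_le_iff.1 (htop.trans (iSup_mono fun _ => inf_le_right))

theorem snd_comp_update {ι : Type*} [DecidableEq ι] (x : ι → Amb K R p) (i : ι)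
    (a : Amb K R p) :
    (fun k => (Function.update x i a k).2) = Function.update (fun k => (x k).2) i a.2 :=
  funext fun k => Function.apply_update (fun _ => Prod.snd) x i a k

end Grading

/-! ### The brackets of the observables -/

section Brackets

variable {K : Type*} [Field K] [CharZero K] {R : Type*} [CommRing R] [Algebra K R] {p : ℕ}
  (ω : Form K R (p + 2))

theorem obsBracket_one_fst_succ (x : Fin 1 → Amb K R p) (m : Fin p) :
    (obsBracket ω 1 x).1 m.succ = ceDiff ((x 0).1 m.castSucc) := rfl

theorem obsBracket_fst (j : ℕ) (x : Fin (j + 2) → Amb K R p) (m : Fin (p + 1)) :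
    (obsBracket ω (j + 2) x).1 m =
      (-1 : ℤ) ^ (j + 3) • multiIns (Pi.single (p + 2) ω) (j + 2) (fun i => (x i).2) m := by
  by_cases h : (m : ℕ) + (j + 2) = p + 2
  · rw [← single_domDomCongr h.symm ω, multiIns_single_eq_iterContr]
    exact dif_pos h
  · rw [multiIns_single_of_ne _ _ h, smul_zero]
    exact dif_neg h

theorem obsBracket_snd (j : ℕ) (x : Fin (j + 2) → Amb K R p) :
    (obsBracket ω (j + 2) x).2 = if j = 0 then ⁅(x 0).2, (x 1).2⁆ else 0 := rfl

theorem obsBracket_snd_of_ne {n : ℕ} (hn : n ≠ 2) (x : Fin n → Amb K R p) :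
    (obsBracket ω n x).2 = 0 :=
  match n, hn, x with
  | 0, _, _ => rfl
  | 1, _, _ => rfl
  | j + 2, hn, x => (obsBracket_snd ω j x).trans (if_neg (by omega))

theorem obsBracket_eq_zero {n : ℕ} (hn : 2 ≤ n) {x : Fin n → Amb K R p} (i : Fin n)
    (hi : (x i).2 = 0) : obsBracket ω n x = 0 := by
  obtain ⟨j, rfl⟩ := Nat.exists_eq_add_of_le' hn
  refine Prod.ext (funext fun m => ?_) ?_
  · rw [obsBracket_fst, (multiIns _ _).map_coord_zero i hi, Pi.zero_apply, smul_zero]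
    rfl
  · rw [obsBracket_snd]
    split_ifs with hj
    · subst hj
      obtain rfl | rfl := (eq_or_ne i 0).imp_right (Fin.eq_one_of_ne_zero i)
      · rw [hi, zero_lie]
        rfl
      · rw [hi, lie_zero]
        rfl
    · rfl

theorem obsBracket_update_add : ∀ {n : ℕ} [DecidableEq (Fin n)] (x : Fin n → Amb K R p)
    (i : Fin n) (a b : Amb K R p), obsBracket ω n (Function.update x i (a + b)) =
      obsBracket ω n (Function.update x i a) + obsBracket ω n (Function.update x i b)
  | 1, _, x, i, a, b => by
    obtain rfl : i = 0 := Subsingleton.elim _ _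
    refine Prod.ext (funext fun m => Fin.cases (add_zero 0).symm (fun m => ?_) m)
      (add_zero 0).symm
    rw [Prod.fst_add, Pi.add_apply]
    simp only [obsBracket_one_fst_succ, Function.update_self]
    exact map_add _ _ _
  | j + 2, _, x, i, a, b => by
    refine Prod.ext (funext fun m => ?_) ?_
    · simp only [Prod.fst_add, Pi.add_apply, obsBracket_fst, snd_comp_update, Prod.snd_add,
        (multiIns _ _).map_update_add, smul_add]
    · simp only [Prod.snd_add, obsBracket_snd]
      split_ifs with hj
      · subst hj
        obtain rfl | rfl := (eq_or_ne i 0).imp_right (Fin.eq_one_of_ne_zero i)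
        all_goals simp
      · exact (add_zero 0).symm

theorem obsBracket_update_smul : ∀ {n : ℕ} [DecidableEq (Fin n)] (x : Fin n → Amb K R p)
    (i : Fin n) (c : K) (a : Amb K R p), obsBracket ω n (Function.update x i (c • a)) =
      c • obsBracket ω n (Function.update x i a)
  | 1, _, x, i, c, a => by
    obtain rfl : i = 0 := Subsingleton.elim _ _
    refine Prod.ext (funext fun m => Fin.cases (smul_zero c).symm (fun m => ?_) m)
      (smul_zero c).symm
    rw [Prod.smul_fst, Pi.smul_apply]
    simp only [obsBracket_one_fst_succ, Function.update_self]
    exact (ceDiff (n := m)).map_smul c _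
  | j + 2, _, x, i, c, a => by
    refine Prod.ext (funext fun m => ?_) ?_
    · rw [Prod.smul_fst, Pi.smul_apply, obsBracket_fst, obsBracket_fst, snd_comp_update,
        snd_comp_update, Prod.smul_snd, ← algebraMap_smul R c a.2,
        (multiIns _ _).map_update_smul, Pi.smul_apply, algebraMap_smul, smul_comm]
    · simp only [Prod.smul_snd, obsBracket_snd]
      split_ifs with hj
      · subst hj
        obtain rfl | rfl := (eq_or_ne i 0).imp_right (Fin.eq_one_of_ne_zero i)
        · simp
        · rw [Function.update_self, Function.update_self,
            Function.update_of_ne zero_ne_one, Function.update_of_ne zero_ne_one]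
          exact lie_smul c _ _
      · exact (smul_zero c).symm

/-- The brackets of the observables as multilinear maps on the ambient space. -/
def obsMultilinear (n : ℕ) : MultilinearMap K (fun _ : Fin n => Amb K R p) (Amb K R p) where
  toFun := obsBracket ω n
  map_update_add' := obsBracket_update_add ω
  map_update_smul' := obsBracket_update_smul ω

theorem obsBracket_mem_ambGrade {n : ℕ} {deg : Fin n → ℤ} {x : Fin n → Amb K R p}
    (hx : ∀ i, x i ∈ ambGrade (K := K) p (deg i)) :
    obsBracket ω n x ∈ ambGrade (K := K) p (∑ i, deg i + 2 - n) := by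
  match n, deg, x, hx with
  | 0, _, _, _ => exact zero_mem _
  | 1, deg, x, hx =>
    refine ⟨fun m => Fin.cases (fun _ => rfl) (fun m hm => ?_) m, fun _ => rfl⟩
    rw [Fin.sum_univ_one, Fin.val_succ] at hm
    have hm' : ((m.castSucc : ℕ) : ℤ) ≠ p + deg 0 := by
      rw [Fin.val_castSucc]
      push_cast at hm
      omega
    rw [obsBracket_one_fst_succ, (hx 0).1 _ hm', map_zero]
  | j + 2, deg, x, hx =>
    by_cases h : ∀ i, deg i = 0
    · simp only [h, Finset.sum_const_zero]
      refine ⟨fun m hm => ?_, fun hj => ?_⟩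
      · rw [obsBracket_fst, multiIns_single_of_ne, smul_zero]
        push_cast at hm
        omega
      · rw [obsBracket_snd, if_neg]
        rintro rfl
        exact hj (by simp)
    · obtain ⟨i, hi⟩ := not_forall.1 h
      rw [obsBracket_eq_zero ω (by omega) i ((hx i).2 hi)]
      exact zero_mem _

theorem obsBracket_perm_of_two_le {n : ℕ} (hn : 2 ≤ n) (x : Fin n → Amb K R p)
    (σ : Equiv.Perm (Fin n)) :
    obsBracket ω n (fun i => x (σ i)) = Equiv.Perm.sign σ • obsBracket ω n x := by
  obtain ⟨j, rfl⟩ := Nat.exists_eq_add_of_le' hn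
  refine Prod.ext (funext fun m => ?_) ?_
  · rw [obsBracket_fst, Prod.smul_fst, Pi.smul_apply, obsBracket_fst, smul_comm]
    exact congrArg ((-1 : ℤ) ^ (j + 3) • ·) (congrFun
      ((multiIns (Pi.single (p + 2) ω) (j + 2)).map_perm (fun i => (x i).2) σ) m)
  · rw [Prod.smul_snd, obsBracket_snd, obsBracket_snd]
    split_ifs with hj
    · subst hj
      obtain rfl | rfl : σ = 1 ∨ σ = Equiv.swap 0 1 := by
        revert σ
        decide
      · simp
      · simp [Equiv.Perm.sign_swap (show (0 : Fin 2) ≠ 1 by decide)]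
    · exact (smul_zero _).symm

theorem obsBracket_perm {n : ℕ} {deg : Fin n → ℤ} {x : Fin n → Amb K R p}
    (hx : ∀ i, x i ∈ ambGrade (K := K) p (deg i)) (σ : Equiv.Perm (Fin n)) :
    obsBracket ω n (fun i => x (σ i)) = skewKoszul σ deg • obsBracket ω n x := by
  rcases lt_or_ge n 2 with hn | hn
  · have : Subsingleton (Fin n) := Fin.subsingleton_iff_le_one.2 (by omega)
    obtain rfl : σ = 1 := Subsingleton.elim _ _
    rw [skewKoszul_one, one_smul]
    rfl
  by_cases h : ∀ i, deg i = 0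
  · rw [skewKoszul_eq_sign σ h, obsBracket_perm_of_two_le ω hn]
  · obtain ⟨i, hi⟩ := not_forall.1 h
    have hzero : (x (σ (σ.symm i))).2 = 0 := by
      rw [σ.apply_symm_apply]
      exact (hx i).2 hi
    rw [obsBracket_eq_zero ω hn i ((hx i).2 hi), smul_zero,
      obsBracket_eq_zero ω hn (σ.symm i) hzero]

end Brackets

/-! ### The Jacobi identities of the observables -/

section Jacobi

variable {K : Type*} [Field K] [CharZero K] {R : Type*} [CommRing R] [Algebra K R] {p : ℕ}

theorem mem_ham_iff {ω : Form K R (p + 2)} {x : Amb K R p} :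
    x ∈ ham ω ↔ ins x.2 ω = -ceDiff (x.1 (Fin.last p)) := Iff.rfl

theorem lieDer_of_mem_ham {ω : Form K R (p + 2)} (hω : ceDiff ω = 0) {x : Amb K R p}
    (hx : x ∈ ham ω) : lieDer x.2 ω = 0 := by
  rw [lieDer_succ, hω, map_zero, zero_add, mem_ham_iff.1 hx, map_neg, ceDiff_ceDiff, neg_zero]

variable (ω : Form K R (p + 2))

theorem obsBracket_one_eq_zero {x : Fin 1 → Amb K R p}
    (h : ∀ m : Fin p, (x 0).1 m.castSucc = 0) : obsBracket ω 1 x = 0 := by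
  refine Prod.ext (funext fun m => Fin.cases rfl (fun m => ?_) m) rfl
  rw [obsBracket_one_fst_succ, h, map_zero]
  rfl

theorem obsBracket_one_obsBracket_one (x : Fin 1 → Amb K R p) :
    (obsBracket ω 1 fun _ => obsBracket ω 1 x) = 0 := by
  refine Prod.ext (funext fun m => Fin.cases rfl (fun m => ?_) m) rfl
  obtain ⟨q, rfl⟩ := Nat.exists_eq_succ_of_ne_zero m.pos.ne'
  exact Fin.cases (map_zero ceDiff) (fun m => ceDiff_ceDiff _) m

theorem obsBracket_one_obsBracket_two (x : Fin 2 → Amb K R p) :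
    (obsBracket ω 1 fun _ => obsBracket ω 2 x) = 0 := by
  refine obsBracket_one_eq_zero ω fun m => ?_
  have hdeg : ((m.castSucc : ℕ)) + 2 ≠ p + 2 := by
    rw [Fin.val_castSucc]
    omega
  rw [obsBracket_fst, multiIns_single_of_ne _ _ hdeg, smul_zero]

theorem obsBracket_one_obsBracket_fst (j : ℕ) (x : Fin (j + 3) → Amb K R p) (m : Fin (p + 1)) :
    (obsBracket ω 1 fun _ => obsBracket ω (j + 3) x).1 m = (-1 : ℤ) ^ (j + 4) •
      totalDiff (multiIns (Pi.single (p + 2) ω) (j + 3) fun i => (x i).2) m := by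
  refine Fin.cases (smul_zero _).symm (fun m => ?_) m
  rw [obsBracket_one_fst_succ, obsBracket_fst ω (j + 1), map_zsmul]
  rfl

theorem obsBracket_vecCons_obsBracket_eq_zero {i r : ℕ} (hi : i ≠ 2) (hr : r ≠ 0)
    (a : Fin i → Amb K R p) (b : Fin r → Amb K R p) :
    obsBracket ω (r + 1) (Matrix.vecCons (obsBracket ω i a) b) = 0 :=
  obsBracket_eq_zero ω (by omega) 0 (obsBracket_snd_of_ne ω hi a)

theorem obsBracket_vecCons_of_eq_zero {r : ℕ} (hr : r = 0) (a : Amb K R p)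
    (b : Fin r → Amb K R p) :
    obsBracket ω (r + 1) (Matrix.vecCons a b) = obsBracket ω 1 fun _ => a := by
  subst hr
  exact congrArg (obsBracket ω 1) (funext fun i => by rw [Subsingleton.elim i 0]; rfl)

variable {ω}

theorem sum_obsBracket_pairs_fst (hω : ceDiff ω = 0) {j : ℕ} {x : Fin (j + 3) → Amb K R p}
    (hx : ∀ i, x i ∈ ham ω) (m : Fin (p + 1)) :
    (∑ i : Fin (j + 2), ∑ k ∈ Finset.Ici i, (-1 : ℤ) ^ (i + k : ℕ) •
      (obsBracket ω (j + 2) (Matrix.vecCons (obsBracket ω 2 ![x i.castSucc, x k.succ])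
        (k.removeNth (i.castSucc.removeNth x)))).1 m) +
      (obsBracket ω 1 fun _ => obsBracket ω (j + 3) x).1 m = 0 := by
  rw [obsBracket_one_obsBracket_fst, totalDiff_multiIns (totalDiff_single hω) _
    (fun i => totalLie_single (lieDer_of_mem_ham hω (hx i)))]
  simp only [Finset.sum_apply, Finset.smul_sum, Pi.smul_apply]
  rw [← Finset.sum_add_distrib]
  refine Finset.sum_eq_zero fun i _ => ?_
  rw [← Finset.sum_add_distrib]
  refine Finset.sum_eq_zero fun k _ => ?_
  have hsnd : (fun l => (Matrix.vecCons (obsBracket ω 2 ![x i.castSucc, x k.succ])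
      (k.removeNth (i.castSucc.removeNth x)) l).2) =
      Matrix.vecCons ⁅(x i.castSucc).2, (x k.succ).2⁆
        (k.removeNth (i.castSucc.removeNth fun l => (x l).2)) :=
    funext fun l => Fin.cases rfl (fun _ => rfl) l
  have hsign :
      (-1 : ℤ) ^ (i + k : ℕ) * (-1) ^ (j + 3) + (-1) ^ (j + 4) * (-1) ^ (i + k : ℕ) = 0 := by
    ring
  rw [obsBracket_fst, hsnd, smul_smul, smul_smul]
  exact (add_smul _ _ _).symm.trans (by rw [hsign, zero_smul])

variable (ω) in
theorem sum_obsBracket_pairs_snd {j : ℕ} (x : Fin (j + 3) → Amb K R p) :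
    ∑ i : Fin (j + 2), ∑ k ∈ Finset.Ici i, (-1 : ℤ) ^ (i + k : ℕ) •
      (obsBracket ω (j + 2) (Matrix.vecCons (obsBracket ω 2 ![x i.castSucc, x k.succ])
        (k.removeNth (i.castSucc.removeNth x)))).2 = 0 := by
  cases j with
  | zero =>
    have h0 : Finset.Ici (0 : Fin 2) = {0, 1} := by decide
    have h1 : Finset.Ici (1 : Fin 2) = {1} := by decide
    rw [Fin.sum_univ_two, h0, h1, Finset.sum_pair zero_ne_one, Finset.sum_singleton]
    change (-1 : ℤ) ^ 0 • ⁅⁅(x 0).2, (x 1).2⁆, (x 2).2⁆ +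
      (-1 : ℤ) ^ 1 • ⁅⁅(x 0).2, (x 2).2⁆, (x 1).2⁆ +
      (-1 : ℤ) ^ 2 • ⁅⁅(x 1).2, (x 2).2⁆, (x 0).2⁆ = 0
    rw [lie_lie, ← lie_skew (x 1).2 ⁅(x 0).2, (x 2).2⁆, ← lie_skew (x 0).2 ⁅(x 1).2, (x 2).2⁆]
    module
  | succ j =>
    refine Finset.sum_eq_zero fun i _ => Finset.sum_eq_zero fun k _ => ?_
    rw [obsBracket_snd_of_ne ω (by omega), smul_zero]

theorem sum_obsBracket_pairs (hω : ceDiff ω = 0) {j : ℕ} {x : Fin (j + 3) → Amb K R p}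
    (hx : ∀ i, x i ∈ ham ω) :
    (∑ i : Fin (j + 2), ∑ k ∈ Finset.Ici i, (-1 : ℤ) ^ (i + k : ℕ) •
      obsBracket ω (j + 2) (Matrix.vecCons (obsBracket ω 2 ![x i.castSucc, x k.succ])
        (k.removeNth (i.castSucc.removeNth x)))) +
      (obsBracket ω 1 fun _ => obsBracket ω (j + 3) x) = 0 := by
  refine Prod.ext (funext fun m => ?_) ?_
  · simp only [Prod.fst_add, Pi.add_apply, Prod.fst_sum, Finset.sum_apply, Prod.smul_fst,
      Pi.smul_apply]
    exact sum_obsBracket_pairs_fst hω hx m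
  · simp only [Prod.snd_add, Prod.snd_sum, Prod.smul_snd]
    rw [sum_obsBracket_pairs_snd, zero_add]
    rfl

variable (ω) in
theorem sum_unshuffles_two_obsBracket {j : ℕ} {deg : Fin (j + 3) → ℤ} (hdeg : ∀ i, deg i = 0)
    (x : Fin (j + 3) → Amb K R p) :
    ∑ σ ∈ unshuffles (j + 3) 2, ((-1 : ℤˣ) ^ (2 * (j + 1)) * skewKoszul σ deg) •
      obsBracket ω (j + 2) (Matrix.vecCons (obsBracket ω 2 fun a => x (σ ⟨a, by omega⟩))
        (fun b : Fin (j + 1) => x (σ ⟨1 + 1 + b, by omega⟩))) =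
    ∑ i : Fin (j + 2), ∑ k ∈ Finset.Ici i, (-1 : ℤ) ^ (i + k : ℕ) •
      obsBracket ω (j + 2) (Matrix.vecCons (obsBracket ω 2 ![x i.castSucc, x k.succ])
        (k.removeNth (i.castSucc.removeNth x))) := by
  rw [sum_unshuffles_two (n := j + 1)]
  refine Finset.sum_congr rfl fun i _ => Finset.sum_congr rfl fun k hk => ?_
  have hpair : (fun a : Fin 2 => x (pairPerm i k ⟨a, by omega⟩)) = ![x i.castSucc, x k.succ] := by
    funext a
    fin_cases a
    · exact congrArg x (pairPerm_zero i k)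
    · exact congrArg x (pairPerm_one (Finset.mem_Ici.1 hk))
  have hrest : (fun b : Fin (j + 1) => x (pairPerm i k ⟨1 + 1 + b, by omega⟩)) =
      k.removeNth (i.castSucc.removeNth x) := by
    funext b
    have hb : (⟨1 + 1 + b, by omega⟩ : Fin (j + 3)) = b.succ.succ :=
      Fin.ext (show 1 + 1 + (b : ℕ) = b + 1 + 1 by omega)
    rw [hb, pairPerm_succ_succ]
    rfl
  rw [hpair, hrest, skewKoszul_eq_sign _ hdeg, sign_pairPerm, (even_two_mul _).neg_one_pow,
    one_mul, Units.smul_def, Units.val_pow_eq_pow_val, Units.val_neg, Units.val_one]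

variable (ω) in
theorem obsBracket_vecCons_obsBracket_two_eq_zero {j : ℕ} {x : Fin (j + 3) → Amb K R p}
    {a : Fin (j + 3)} (ha : (x a).2 = 0) (σ : Equiv.Perm (Fin (j + 3))) :
    obsBracket ω (j + 2) (Matrix.vecCons (obsBracket ω 2 fun a => x (σ ⟨a, by omega⟩))
      (fun b : Fin (j + 1) => x (σ ⟨1 + 1 + b, by omega⟩))) = 0 := by
  obtain ⟨c, rfl⟩ := σ.surjective a
  rcases lt_or_ge (c : ℕ) 2 with hc | hc
  · refine obsBracket_eq_zero ω (by omega) 0 ?_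
    rw [Matrix.cons_val_zero, obsBracket_eq_zero ω le_rfl ⟨c, hc⟩ ha]
    rfl
  · refine obsBracket_eq_zero ω (by omega) (Fin.succ ⟨c - 2, by omega⟩) ?_
    rw [Matrix.cons_val_succ, ← ha]
    exact congrArg (fun c => (x (σ c)).2) (Fin.ext (show 1 + 1 + ((c : ℕ) - 2) = c by omega))

theorem sum_unshuffles_two_obsBracket_add (hω : ceDiff ω = 0) {j : ℕ} {deg : Fin (j + 3) → ℤ}
    {x : Fin (j + 3) → Amb K R p} (hdeg : ∀ i, x i ∈ ambGrade (K := K) p (deg i))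
    (hx : ∀ i, x i ∈ ham ω) :
    (∑ σ ∈ unshuffles (j + 3) 2, ((-1 : ℤˣ) ^ (2 * (j + 1)) * skewKoszul σ deg) •
      obsBracket ω (j + 2) (Matrix.vecCons (obsBracket ω 2 fun a => x (σ ⟨a, by omega⟩))
        (fun b : Fin (j + 1) => x (σ ⟨1 + 1 + b, by omega⟩)))) +
      (obsBracket ω 1 fun _ => obsBracket ω (j + 3) x) = 0 := by
  by_cases h : ∀ i, deg i = 0
  · rw [sum_unshuffles_two_obsBracket ω h, sum_obsBracket_pairs hω hx]
  · obtain ⟨a, ha⟩ := not_forall.1 h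
    have ha' : (x a).2 = 0 := (hdeg a).2 ha
    rw [obsBracket_eq_zero ω (by omega) a ha', obsBracket_one_eq_zero ω fun _ => rfl, add_zero]
    exact Finset.sum_eq_zero fun σ _ =>
      smul_eq_zero_of_right _ (obsBracket_vecCons_obsBracket_two_eq_zero ω ha' σ)

variable (ω) in
theorem sum_unshuffles_self_obsBracket {n : ℕ} (deg : Fin (n + 1) → ℤ)
    (x : Fin (n + 1) → Amb K R p) :
    ∑ σ ∈ unshuffles (n + 1) (n + 1),
      ((-1 : ℤˣ) ^ ((n + 1) * (n + 1 - (n + 1))) * skewKoszul σ deg) •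
        obsBracket ω (n + 1 - (n + 1) + 1) (Matrix.vecCons
          (obsBracket ω (n + 1) fun a => x (σ ⟨a, by omega⟩))
          (fun b : Fin (n + 1 - (n + 1)) => x (σ ⟨n + 1 + b, by omega⟩))) =
      obsBracket ω 1 fun _ => obsBracket ω (n + 1) x := by
  rw [unshuffles_self, Finset.sum_singleton, skewKoszul_one,
    obsBracket_vecCons_of_eq_zero ω (Nat.sub_self _), Nat.sub_self, mul_zero, pow_zero, one_mul,
    one_smul]
  rfl

theorem obsBracket_jacobi (hω : ceDiff ω = 0) {n : ℕ} {deg : Fin n → ℤ} {x : Fin n → Amb K R p}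
    (hdeg : ∀ i, x i ∈ ambGrade (K := K) p (deg i)) (hx : ∀ i, x i ∈ ham ω) :
    ∑ i : Fin n, ∑ σ ∈ unshuffles n (i + 1),
      ((-1 : ℤˣ) ^ (((i : ℕ) + 1) * (n - (i + 1))) * skewKoszul σ deg) •
        obsBracket ω (n - (i + 1) + 1) (Matrix.vecCons
          (obsBracket ω (i + 1) fun a => x (σ ⟨a, by omega⟩))
          (fun b : Fin (n - (i + 1)) => x (σ ⟨i + 1 + b, by omega⟩))) = 0 := by
  have vanish (i : Fin n) (hi : (i : ℕ) ≠ 1) (hi' : (i : ℕ) + 1 ≠ n) :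
      ∑ σ ∈ unshuffles n (i + 1),
        ((-1 : ℤˣ) ^ (((i : ℕ) + 1) * (n - (i + 1))) * skewKoszul σ deg) •
          obsBracket ω (n - (i + 1) + 1) (Matrix.vecCons
            (obsBracket ω (i + 1) fun a => x (σ ⟨a, by omega⟩))
            (fun b : Fin (n - (i + 1)) => x (σ ⟨i + 1 + b, by omega⟩))) = 0 :=
    Finset.sum_eq_zero fun σ _ => smul_eq_zero_of_right _
      (obsBracket_vecCons_obsBracket_eq_zero ω (by omega) (by omega) _ _)
  match n, deg, x, hdeg, hx, vanish with
  | 0, _, _, _, _, _ => rfl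
  | 1, deg, x, _, _, _ =>
    rw [Fin.sum_univ_one]
    exact (sum_unshuffles_self_obsBracket ω deg x).trans (obsBracket_one_obsBracket_one ω x)
  | 2, deg, x, _, _, vanish =>
    rw [Fin.sum_univ_two, vanish 0 (by simp) (by simp), zero_add]
    exact (sum_unshuffles_self_obsBracket ω deg x).trans (obsBracket_one_obsBracket_two ω x)
  | j + 3, deg, x, hdeg, hx, vanish =>
    rw [Finset.sum_eq_add_of_mem (⟨1, by omega⟩ : Fin (j + 3)) (Fin.last (j + 2))
      (Finset.mem_univ _) (Finset.mem_univ _) (by simp [Fin.ext_iff])]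
    · refine Eq.trans (congrArg _ ?_) (sum_unshuffles_two_obsBracket_add hω hdeg hx)
      exact sum_unshuffles_self_obsBracket ω deg x
    · rintro i - ⟨h1, h2⟩
      exact vanish i (fun h => h1 (Fin.ext h)) fun h => h2 (Fin.ext (Nat.succ_injective h))

end Jacobi

/-! ### The `L_∞`-algebra of a space of observables -/

section SpaceOfObservables

variable {K : Type*} [Field K] [CharZero K] {R : Type*} [CommRing R] [Algebra K R] {p : ℕ}
  {ω : Form K R (p + 2)} (hω : ceDiff ω = 0) {W N : Submodule K (Amb K R p)} (hW : W ≤ ham ω)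
  (hgrade : IsGradedSubmodule (ambGrade p) W)
  (hstable : ∀ (n : ℕ) (x : Fin n → Amb K R p), (∀ i, x i ∈ W) → obsBracket ω n x ∈ W)

/-- The `L_∞`-algebra structure on a graded space of observables that is stable under the
brackets. -/
def obsLInfinity : LInfinityAlgebra K fun i => (ambGrade p i).comap W.subtype where
  isInternal := hgrade.isInternal_comap_subtype isInternal_ambGrade
  l n := ((obsMultilinear ω n).compLinearMap fun _ => W.subtype).codRestrict W fun x =>
    hstable n _ fun i => (x i).2
  l_zero := rfl
  l_mem n deg x hx := obsBracket_mem_ambGrade ω hx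
  skew n deg x hx σ := Subtype.ext (obsBracket_perm ω hx σ)
  jacobi n deg x hx := by
    refine Subtype.ext (Eq.trans ?_ (obsBracket_jacobi hω hx fun i => hW (x i).2))
    rw [Submodule.coe_sum]
    refine Finset.sum_congr rfl fun i _ => ?_
    rw [Submodule.coe_sum]
    refine Finset.sum_congr rfl fun σ _ => congrArg (fun y : Amb K R p =>
      ((-1 : ℤˣ) ^ (((i : ℕ) + 1) * (n - (i + 1))) * skewKoszul σ deg) • y) ?_
    exact congrArg (obsBracket ω _) (funext fun b => Fin.cases rfl (fun _ => rfl) b)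

theorem obsLInfinity_l (n : ℕ) (x : Fin n → W) :
    ((obsLInfinity hω hW hgrade hstable).l n x : Amb K R p) =
      obsBracket ω n fun i => (x i : Amb K R p) := rfl

include hω hW hgrade hstable in
theorem exists_quotient_lInfinity (hNW : N ≤ W) (hgradeN : IsGradedSubmodule (ambGrade p) N)
    (hideal : ∀ (n : ℕ) (x : Fin n → Amb K R p), (∀ i, x i ∈ W) → (∃ i, x i ∈ N) →
      obsBracket ω n x ∈ N) :
    ∃ Λ : LInfinityAlgebra K fun i =>
        ((ambGrade p i).comap W.subtype).map (N.submoduleOf W).mkQ,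
      ∀ (n : ℕ) (x : Fin n → W), ∃ h : obsBracket ω n (fun i => (x i : Amb K R p)) ∈ W,
        Λ.l n (fun i => Submodule.Quotient.mk (x i)) = Submodule.Quotient.mk ⟨_, h⟩ :=
  have hl (n : ℕ) (x : Fin n → W) (i : Fin n) (hi : x i ∈ N.submoduleOf W) :
      (obsLInfinity hω hW hgrade hstable).l n x ∈ N.submoduleOf W :=
    hideal n _ (fun i => (x i).2) ⟨i, hi⟩
  ⟨(obsLInfinity hω hW hgrade hstable).quotient (hgradeN.submoduleOf hNW) hl,
    fun n x => ⟨hstable n _ fun i => (x i).2, quotientMultilinearMap_mkQ _ _ _ (hl n) x⟩⟩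

end SpaceOfObservables

/-! ### Derivations and forms of the constraint algebra -/

section Constraint

variable {K : Type*} [Field K] {R : Type*} [CommRing R] [Algebra K R]

theorem smul_lie_der (f : R) (X Y : Der K R) : ⁅f • X, Y⁆ = f • ⁅X, Y⁆ - Y f • X := by
  ext r
  simp only [Derivation.commutator_apply, Derivation.sub_apply, Derivation.smul_apply,
    smul_eq_mul, Derivation.leibniz]
  ring

theorem contr_add_left (X Y : Der K R) {n : ℕ} (α : Form K R n) :
    contr (X + Y) α = contr X α + contr Y α := by
  cases n with
  | zero => exact (add_zero _).symm
  | succ n => exact ins_add_left X Y α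

theorem contr_smul_left (f : R) (X : Der K R) {n : ℕ} (α : Form K R n) :
    contr (f • X) α = f • contr X α := by
  cases n with
  | zero => exact (smul_zero _).symm
  | succ n => exact ins_smul_left f X α

variable {I : Ideal R}

theorem lie_mem_derW {X Y : Der K R} (hX : X ∈ derW I) (hY : Y ∈ derW I) : ⁅X, Y⁆ ∈ derW I :=
  fun f hf => by
    rw [Derivation.commutator_apply]
    exact I.sub_mem (hX _ (hY f hf)) (hY _ (hX f hf))

theorem derN_le_derW : derN (K := K) I ≤ derW I := fun _ hX f _ => hX f

theorem smul_top_le_derN : I • (⊤ : Submodule R (Der K R)) ≤ derN I :=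
  Submodule.smul_le.2 fun _ hf _ _ _ => I.mul_mem_right _ hf

theorem ins_mem_formN {n : ℕ} {α : Form K R (n + 1)} (hα : α ∈ formN I (n + 1)) {X : Der K R}
    (hX : X ∈ derW I) : ins X α ∈ formN I n := fun v hv => by
  rw [ins_apply]
  exact hα _ fun i => Fin.cases hX hv i

theorem contr_mem_formN {n : ℕ} {α : Form K R n} (hα : α ∈ formN I n) {X : Der K R}
    (hX : X ∈ derW I) : contr X α ∈ formN I (n - 1) := by
  cases n with
  | zero => exact zero_mem _
  | succ n => exact ins_mem_formN hα hX

theorem smul_mem_formN {f : R} (hf : f ∈ I) {n : ℕ} (α : Form K R n) : f • α ∈ formN I n :=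
  fun _ _ => I.mul_mem_right _ hf

theorem formW_eq_top (hI : derN (K := K) I ≤ I • ⊤) (n : ℕ) : formW (K := K) I n = ⊤ := by
  refine eq_top_iff.2 fun α _ w hw => ?_
  refine Submodule.smul_induction_on (hI hw) (fun f hf X _ => ?_) fun X Y hX hY => ?_
  · rw [contr_smul_left]
    exact smul_mem_formN hf _
  · rw [contr_add_left]
    exact add_mem hX hY

/-- The explicit form `C^∞(M) · F + I 𝔛(M)` of the module `symLR I F`. -/
abbrev spanLR (I : Ideal R) (F : Set (Der K R)) : Submodule R (Der K R) :=
  Submodule.span R F ⊔ I • ⊤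

theorem subset_spanLR {F : Set (Der K R)} : F ⊆ spanLR I F :=
  Submodule.subset_span.trans (SetLike.coe_subset_coe.2 le_sup_left)

theorem spanLR_le_derW {F : Set (Der K R)} (hF : ∀ ξ ∈ F, ξ ∈ derW I) : spanLR I F ≤ derW I :=
  sup_le (Submodule.span_le.2 hF) (smul_top_le_derN.trans derN_le_derW)

theorem spanLR_induction {F : Set (Der K R)} {P : Der K R → Prop}
    (hF : ∀ (f : R), ∀ ξ ∈ F, P (f • ξ)) (hI : ∀ f ∈ I, ∀ X, P (f • X))
    (hadd : ∀ X Y, P X → P Y → P (X + Y)) {ξ : Der K R} (hξ : ξ ∈ spanLR I F) : P ξ := by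
  have hzero : P 0 := zero_smul R (0 : Der K R) ▸ hI 0 I.zero_mem 0
  obtain ⟨Y, hY, Z, hZ, rfl⟩ := Submodule.mem_sup.1 hξ
  refine hadd _ _ ?_ ?_
  · exact Submodule.closure_induction (p := fun X _ => P X) hzero (fun X Y _ _ => hadd X Y) hF hY
  · exact Submodule.smul_induction_on hZ (fun f hf X _ => hI f hf X) hadd

theorem lie_mem_spanLR {F : Set (Der K R)} {X : Der K R} (hX : X ∈ derW I)
    (hFX : ∀ ξ ∈ F, ⁅ξ, X⁆ ∈ spanLR I F) {ξ : Der K R} (hξ : ξ ∈ spanLR I F) :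
    ⁅ξ, X⁆ ∈ spanLR I F := by
  refine spanLR_induction (P := fun ξ => ⁅ξ, X⁆ ∈ spanLR I F) ?_ ?_ ?_ hξ
  · intro f ξ hξ
    rw [smul_lie_der]
    exact sub_mem (Submodule.smul_mem _ _ (hFX ξ hξ)) (Submodule.smul_mem _ _ (subset_spanLR hξ))
  · intro f hf Y
    rw [smul_lie_der]
    exact Submodule.mem_sup_right (sub_mem (Submodule.smul_mem_smul hf trivial)
      (Submodule.smul_mem_smul (hX f hf) trivial))
  · intro Y Z hY hZ
    rw [add_lie]
    exact add_mem hY hZ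

theorem lie_mem_spanLR_of_mem {F : LieSubalgebra K (Der K R)} (hF : ∀ ξ ∈ F, ξ ∈ derW I)
    {ξ η : Der K R} (hξ : ξ ∈ spanLR I (F : Set (Der K R)))
    (hη : η ∈ spanLR I (F : Set (Der K R))) : ⁅ξ, η⁆ ∈ spanLR I (F : Set (Der K R)) := by
  refine lie_mem_spanLR (spanLR_le_derW hF hη) (fun ξ hξ => ?_) hξ
  rw [← lie_skew]
  exact neg_mem (lie_mem_spanLR (hF ξ hξ) (fun η hη => subset_spanLR (F.lie_mem hη hξ)) hη)

theorem symLR_eq_spanLR {F : LieSubalgebra K (Der K R)} (hF : ∀ ξ ∈ F, ξ ∈ derW I)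
    (hI : derN (K := K) I ≤ I • ⊤) :
    symLR I (F : Set (Der K R)) = spanLR I (F : Set (Der K R)) := by
  refine le_antisymm (sInf_le ⟨subset_spanLR, hI.trans le_sup_right, ?_⟩) (le_sInf ?_)
  · exact fun X hX Y hY => lie_mem_spanLR_of_mem hF hX hY
  · rintro N ⟨hFN, hN, -⟩
    exact sup_le (Submodule.span_le.2 hFN) (smul_top_le_derN.trans hN)

variable [CharZero K]

theorem ceDiff_mem_formN {n : ℕ} {α : Form K R n} (hα : α ∈ formN I n) :
    ceDiff α ∈ formN I (n + 1) := by
  intro v hv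
  rw [ceDiff_apply]
  have hderiv (i : Fin (n + 1)) : v i (α (i.removeNth v)) ∈ I := hv i _ (hα _ fun k => hv _)
  cases n with
  | zero => exact hderiv 0
  | succ n =>
    refine I.add_mem (Ideal.sum_mem _ fun i _ => zsmul_mem (hderiv i) _)
      (Ideal.sum_mem _ fun i _ => Ideal.sum_mem _ fun j _ => zsmul_mem (hα _ fun k => ?_) _)
    exact Fin.cases (lie_mem_derW (hv _) (hv _)) (fun k => hv _) k

theorem lieDer_mem_formN {n : ℕ} {α : Form K R n} (hα : α ∈ formN I n) {X : Der K R}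
    (hX : X ∈ derW I) : lieDer X α ∈ formN I n := by
  cases n with
  | zero => exact ins_mem_formN (ceDiff_mem_formN hα) hX
  | succ n =>
    rw [lieDer_succ]
    exact add_mem (ins_mem_formN (ceDiff_mem_formN hα) hX) (ceDiff_mem_formN (ins_mem_formN hα hX))

theorem lieDer_add_left (X Y : Der K R) {n : ℕ} (α : Form K R n) :
    lieDer (X + Y) α = lieDer X α + lieDer Y α := by
  cases n with
  | zero => exact ins_add_left _ _ _
  | succ n =>
    rw [lieDer_succ, lieDer_succ, lieDer_succ, ins_add_left, ins_add_left, map_add]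
    abel

theorem lieDer_smul_left_zero (f : R) (X : Der K R) (α : Form K R 0) :
    lieDer (f • X) α = f • lieDer X α := rfl

theorem lieDer_smul_left_apply (f : R) (X : Der K R) {n : ℕ} (α : Form K R (n + 1))
    (v : Fin (n + 1) → Der K R) :
    lieDer (f • X) α v = f * lieDer X α v +
      ∑ j : Fin (n + 1), (-1 : ℤ) ^ (j : ℕ) • (v j f * ins X α (j.removeNth v)) := by
  have hlie (Y : Der K R) (w : Fin n → Der K R) :
      α (Matrix.vecCons (f • ⁅X, Y⁆ - Y f • X) w) =
        f * α (Matrix.vecCons ⁅X, Y⁆ w) - Y f * α (Matrix.vecCons X w) := by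
    simp only [← ins_apply, ins_sub_left, ins_smul_left]
    rfl
  rw [lieDer_succ_apply, lieDer_succ_apply]
  simp only [smul_lie_der, hlie, smul_sub, Finset.sum_sub_distrib, Derivation.smul_apply,
    smul_eq_mul, mul_sub, Finset.mul_sum, ins_apply, mul_smul_comm]
  ring

theorem lieDer_smul_left_mem_formN {n : ℕ} {α : Form K R n} {X : Der K R} (f : R)
    (hcontr : contr X α ∈ formN I (n - 1)) (hlie : lieDer X α ∈ formN I n) :
    lieDer (f • X) α ∈ formN I n := by
  cases n with
  | zero =>
    rw [lieDer_smul_left_zero]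
    exact Submodule.smul_mem _ f hlie
  | succ n =>
    intro v hv
    rw [lieDer_smul_left_apply]
    exact I.add_mem (I.mul_mem_left f (hlie v hv)) (Ideal.sum_mem _ fun j _ =>
      zsmul_mem (I.mul_mem_left _ (hcontr _ fun k => hv _)) _)

theorem lieDer_smul_mem_formN {f : R} (hf : f ∈ I) (X : Der K R) {n : ℕ} (α : Form K R n) :
    lieDer (f • X) α ∈ formN I n := by
  cases n with
  | zero =>
    rw [lieDer_smul_left_zero]
    exact smul_mem_formN hf _
  | succ n =>
    intro v hv
    rw [lieDer_smul_left_apply]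
    exact I.add_mem (I.mul_mem_right _ hf) (Ideal.sum_mem _ fun j _ =>
      zsmul_mem (I.mul_mem_right _ (hv j f hf)) _)

theorem contr_lieDer_mem_formN_of_mem_spanLR {F : Set (Der K R)} {n : ℕ} {α : Form K R n}
    (hα : ∀ ξ ∈ F, contr ξ α ∈ formN I (n - 1) ∧ lieDer ξ α ∈ formN I n)
    {ξ : Der K R} (hξ : ξ ∈ spanLR I F) :
    contr ξ α ∈ formN I (n - 1) ∧ lieDer ξ α ∈ formN I n := by
  refine spanLR_induction
    (P := fun ξ : Der K R => contr ξ α ∈ formN I (n - 1) ∧ lieDer ξ α ∈ formN I n) ?_ ?_ ?_ hξ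
  · intro f ξ hξ
    obtain ⟨hcontr, hlie⟩ := hα ξ hξ
    exact ⟨contr_smul_left f ξ α ▸ Submodule.smul_mem _ f hcontr,
      lieDer_smul_left_mem_formN f hcontr hlie⟩
  · exact fun f hf X => ⟨contr_smul_left f X α ▸ smul_mem_formN hf _, lieDer_smul_mem_formN hf X α⟩
  · intro X Y hX hY
    rw [contr_add_left, lieDer_add_left]
    exact ⟨add_mem hX.1 hY.1, add_mem hX.2 hY.2⟩

end Constraint

/-! ### Reduction of the observables -/

section Reduction

variable {K : Type*} [Field K] [CharZero K] {R : Type*} [CommRing R] [Algebra K R] {p : ℕ}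
  {I : Ideal R}

theorem mem_basicW_symLR_iff {F : LieSubalgebra K (Der K R)} (hF : ∀ ξ ∈ F, ξ ∈ derW I)
    (hI : derN (K := K) I ≤ I • ⊤) {n : ℕ} {α : Form K R n} :
    α ∈ basicW I (symLR I (F : Set (Der K R))) n ↔
      ∀ ξ ∈ F, contr ξ α ∈ formN I (n - 1) ∧ lieDer ξ α ∈ formN I n := by
  rw [symLR_eq_spanLR hF hI]
  refine ⟨fun h ξ hξ => h.2 ξ (subset_spanLR hξ), fun h => ⟨?_, fun ξ hξ => ?_⟩⟩
  · rw [formW_eq_top hI]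
    trivial
  · exact contr_lieDer_mem_formN_of_mem_spanLR h hξ

theorem mem_basicW_symLR_of_ceDiff_eq_zero {F : LieSubalgebra K (Der K R)}
    (hF : ∀ ξ ∈ F, ξ ∈ derW I) (hI : derN (K := K) I ≤ I • ⊤) {n : ℕ} {ω : Form K R (n + 1)}
    (hω : ceDiff ω = 0) (hωF : ∀ ξ ∈ F, ins ξ ω ∈ formN I n) :
    ω ∈ basicW I (symLR I (F : Set (Der K R))) (n + 1) := by
  rw [mem_basicW_symLR_iff hF hI]
  refine fun ξ hξ => ⟨hωF ξ hξ, ?_⟩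
  rw [lieDer_succ, hω, map_zero, zero_add]
  exact ceDiff_mem_formN (hωF ξ hξ)

variable {L : Submodule R (Der K R)}

theorem mem_basicW_of_mem_formN (hL : L ≤ derW I) {n : ℕ} {α : Form K R n} (hα : α ∈ formN I n) :
    α ∈ basicW I L n :=
  ⟨fun _ hw => contr_mem_formN hα (derN_le_derW hw),
    fun _ hξ => ⟨contr_mem_formN hα (hL hξ), lieDer_mem_formN hα (hL hξ)⟩⟩

theorem ins_mem_basicW (hI : derN (K := K) I ≤ I • ⊤) {n : ℕ} {α : Form K R (n + 1)}
    (hα : α ∈ basicW I L (n + 1)) {X : Der K R} (hX : X ∈ normW I L) :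
    ins X α ∈ basicW I L n := by
  refine ⟨by rw [formW_eq_top hI]; trivial, fun ξ hξ => ⟨?_, ?_⟩⟩
  · cases n with
    | zero => exact zero_mem _
    | succ n =>
      rw [contr_succ, ins_ins_swap]
      exact neg_mem (ins_mem_formN (hα.2 ξ hξ).1 hX.1)
  · rw [lieDer_ins]
    exact add_mem (ins_mem_formN (hα.2 ξ hξ).2 hX.1) (hα.2 _ (hX.2 ξ hξ)).1

theorem ceDiff_mem_basicW (hI : derN (K := K) I ≤ I • ⊤) {n : ℕ} {α : Form K R n}
    (hα : α ∈ basicW I L n) : ceDiff α ∈ basicW I L (n + 1) := by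
  refine ⟨by rw [formW_eq_top hI]; trivial, fun ξ hξ => ⟨?_, ?_⟩⟩
  · rw [contr_succ]
    cases n with
    | zero => exact (hα.2 ξ hξ).2
    | succ n =>
      rw [← add_sub_cancel_right (ins ξ (ceDiff α)) (ceDiff (ins ξ α)), ← lieDer_succ]
      exact sub_mem (hα.2 ξ hξ).2 (ceDiff_mem_formN (hα.2 ξ hξ).1)
  · rw [lieDer_ceDiff]
    exact ceDiff_mem_formN (hα.2 ξ hξ).2

theorem multiIns_mem_basicW (hI : derN (K := K) I ≤ I • ⊤) {α : TotalForm K R}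
    (hα : ∀ m, α m ∈ basicW I L m) : ∀ {n : ℕ} {X : Fin n → Der K R},
      (∀ i, X i ∈ normW I L) → ∀ m, multiIns α n X m ∈ basicW I L m
  | 0, X, _, m => by
    rw [multiIns_zero]
    exact hα m
  | n + 1, X, hX, m => by
    rw [multiIns_succ, totalIns_apply]
    exact ins_mem_basicW hI (multiIns_mem_basicW hI hα (fun i => hX i.succ) (m + 1)) (hX 0)

theorem multiIns_mem_formN (hI : derN (K := K) I ≤ I • ⊤) {α : TotalForm K R}
    (hα : ∀ m, α m ∈ basicW I L m) : ∀ {n : ℕ} {X : Fin n → Der K R},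
      (∀ i, X i ∈ normW I L) → ∀ i, X i ∈ L → ∀ m, multiIns α n X m ∈ formN I m
  | 0, _, _, i, _, _ => i.elim0
  | n + 1, X, hX, i, hi, m => by
    rw [multiIns_succ, totalIns_apply]
    revert hi
    refine Fin.cases (fun hi => ?_) (fun i hi => ?_) i
    · exact ((multiIns_mem_basicW hI hα (fun i => hX i.succ) (m + 1)).2 _ hi).1
    · exact ins_mem_formN (multiIns_mem_formN hI hα (fun i => hX i.succ) i hi (m + 1)) (hX 0).1

theorem single_mem_basicW {N : ℕ} {ω : Form K R N} (hω : ω ∈ basicW I L N) (m : ℕ) :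
    (Pi.single N ω : TotalForm K R) m ∈ basicW I L m := by
  rcases eq_or_ne m N with rfl | h
  · rwa [Pi.single_eq_same]
  · rw [Pi.single_eq_of_ne h]
    exact zero_mem _

omit [CharZero K] in
theorem lie_mem_normW {X Y : Der K R} (hX : X ∈ normW I L) (hY : Y ∈ normW I L) :
    ⁅X, Y⁆ ∈ normW I L := by
  refine ⟨lie_mem_derW hX.1 hY.1, fun ξ hξ => ?_⟩
  rw [leibniz_lie, ← lie_skew X]
  exact add_mem (hY.2 _ (hX.2 ξ hξ)) (neg_mem (hX.2 _ (hY.2 ξ hξ)))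

omit [CharZero K] in
theorem mem_normW_symLR_iff {F : LieSubalgebra K (Der K R)} (hF : ∀ ξ ∈ F, ξ ∈ derW I)
    (hI : derN (K := K) I ≤ I • ⊤) {X : Der K R} :
    X ∈ normW I (symLR I (F : Set (Der K R))) ↔
      X ∈ derW I ∧ ∀ ξ ∈ F, ⁅ξ, X⁆ ∈ spanLR I (F : Set (Der K R)) := by
  rw [symLR_eq_spanLR hF hI]
  exact ⟨fun h => ⟨h.1, fun ξ hξ => h.2 ξ (subset_spanLR hξ)⟩,
    fun h => ⟨h.1, fun ξ hξ => lie_mem_spanLR h.1 h.2 hξ⟩⟩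

theorem mem_hamW_iff {F : Set (Der K R)} {ω : Form K R (p + 2)} {x : Amb K R p} :
    x ∈ hamW I F ω ↔ x ∈ ham ω ∧ (∀ m : Fin (p + 1), x.1 m ∈ basicW I (symLR I F) m) ∧
      x.2 ∈ normW I (symLR I F) := by
  simp [hamW, Submodule.mem_prod, Submodule.mem_pi]

theorem mem_hamN_iff {F : Set (Der K R)} {ω : Form K R (p + 2)} {x : Amb K R p} :
    x ∈ hamN I F ω ↔ x ∈ ham ω ∧ (∀ m : Fin (p + 1), x.1 m ∈ formN I m) ∧ x.2 ∈ symLR I F := by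
  simp [hamN, Submodule.mem_prod, Submodule.mem_pi]

theorem hamN_le_hamW {F : LieSubalgebra K (Der K R)} (hF : ∀ ξ ∈ F, ξ ∈ derW I)
    (hI : derN (K := K) I ≤ I • ⊤) (ω : Form K R (p + 2)) :
    hamN I (F : Set (Der K R)) ω ≤ hamW I (F : Set (Der K R)) ω := by
  intro x hx
  rw [mem_hamN_iff, symLR_eq_spanLR hF hI] at hx
  rw [mem_hamW_iff, symLR_eq_spanLR hF hI]
  exact ⟨hx.1, fun m => mem_basicW_of_mem_formN (spanLR_le_derW hF) (hx.2.1 m),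
    spanLR_le_derW hF hx.2.2, fun ξ hξ => lie_mem_spanLR_of_mem hF hξ hx.2.2⟩

theorem ambProj_mem_ham {ω : Form K R (p + 2)} (i : ℤ) {x : Amb K R p} (hx : x ∈ ham ω) :
    ambProj p i x ∈ ham ω := by
  rw [mem_ham_iff] at hx ⊢
  rw [ambProj_fst, ambProj_snd]
  by_cases h : i = 0
  · rw [if_pos h, if_pos (by rw [Fin.val_last]; omega), hx]
  · rw [if_neg h, if_neg (by rw [Fin.val_last]; omega), ins_zero_left, map_zero, neg_zero]

theorem isGradedSubmodule_ham (ω : Form K R (p + 2)) : IsGradedSubmodule (ambGrade p) (ham ω) :=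
  isGradedSubmodule_ambGrade fun i _ hx => ambProj_mem_ham i hx

theorem isGradedSubmodule_hamW (I : Ideal R) (F : Set (Der K R)) (ω : Form K R (p + 2)) :
    IsGradedSubmodule (ambGrade p) (hamW I F ω) := by
  refine isGradedSubmodule_ambGrade fun i x hx => ?_
  rw [mem_hamW_iff] at hx ⊢
  refine ⟨ambProj_mem_ham i hx.1, fun m => ?_, ?_⟩
  · rw [ambProj_fst]
    split_ifs
    exacts [hx.2.1 m, zero_mem _]
  · rw [ambProj_snd]
    split_ifs
    exacts [hx.2.2, zero_mem _]

theorem isGradedSubmodule_hamN (I : Ideal R) (F : Set (Der K R)) (ω : Form K R (p + 2)) :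
    IsGradedSubmodule (ambGrade p) (hamN I F ω) := by
  refine isGradedSubmodule_ambGrade fun i x hx => ?_
  rw [mem_hamN_iff] at hx ⊢
  refine ⟨ambProj_mem_ham i hx.1, fun m => ?_, ?_⟩
  · rw [ambProj_fst]
    split_ifs
    exacts [hx.2.1 m, zero_mem _]
  · rw [ambProj_snd]
    split_ifs
    exacts [hx.2.2, zero_mem _]

theorem ins_lie_of_mem_ham {ω : Form K R (p + 2)} (hω : ceDiff ω = 0) {x y : Amb K R p}
    (hx : x ∈ ham ω) (hy : y ∈ ham ω) : ins ⁅x.2, y.2⁆ ω = ceDiff (ins x.2 (ins y.2 ω)) := by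
  have hclosed : ceDiff (ins y.2 ω) = 0 := by
    rw [mem_ham_iff.1 hy, map_neg, ceDiff_ceDiff, neg_zero]
  have hcomm := lieDer_ins x.2 y.2 ω
  rw [lieDer_of_mem_ham hω hx, map_zero, zero_add, lieDer_succ, hclosed, map_zero,
    zero_add] at hcomm
  exact hcomm.symm

theorem obsBracket_two_fst_last (ω : Form K R (p + 2)) (x : Fin 2 → Amb K R p) :
    (obsBracket ω 2 x).1 (Fin.last p) = -ins (x 0).2 (ins (x 1).2 ω) := by
  have hins : multiIns (Pi.single (p + 2) ω) 2 (fun i => (x i).2) p =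
      ins (x 0).2 (ins (x 1).2 ω) := by
    rw [multiIns_succ, multiIns_succ, multiIns_zero, totalIns_apply, totalIns_apply,
      Pi.single_eq_same]
    rfl
  rw [obsBracket_fst ω 0, Odd.neg_one_pow (by decide), neg_one_smul]
  exact congrArg Neg.neg hins

theorem obsBracket_mem_ham {ω : Form K R (p + 2)} (hω : ceDiff ω = 0) :
    ∀ {n : ℕ} {x : Fin n → Amb K R p}, (∀ i, x i ∈ ham ω) → obsBracket ω n x ∈ ham ω
  | 0, _, _ => zero_mem (ham ω)
  | 1, x, _ => by
    rw [mem_ham_iff]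
    refine (ins_zero_left ω).trans (Eq.symm (neg_eq_zero.2 ?_))
    cases p with
    | zero => exact map_zero ceDiff
    | succ p => exact ceDiff_ceDiff _
  | 2, x, hx => by
    rw [mem_ham_iff, obsBracket_two_fst_last, map_neg, neg_neg]
    exact ins_lie_of_mem_ham hω (hx 0) (hx 1)
  | j + 3, x, _ => by
    have hdeg : (Fin.last p : ℕ) + (j + 3) ≠ p + 2 := by
      rw [Fin.val_last]
      omega
    rw [mem_ham_iff, obsBracket_snd_of_ne ω (by omega), ins_zero_left, obsBracket_fst ω (j + 1),
      multiIns_single_of_ne _ _ hdeg, smul_zero, map_zero, neg_zero]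

variable {F : Set (Der K R)} {ω : Form K R (p + 2)}

theorem obsBracket_mem_hamW (hI : derN (K := K) I ≤ I • ⊤) (hω : ceDiff ω = 0)
    (hωW : ω ∈ basicW I (symLR I F) (p + 2)) {n : ℕ} {x : Fin n → Amb K R p}
    (hx : ∀ i, x i ∈ hamW I F ω) : obsBracket ω n x ∈ hamW I F ω := by
  simp only [mem_hamW_iff] at hx ⊢
  refine ⟨obsBracket_mem_ham hω fun i => (hx i).1, ?_⟩
  match n, x, hx with
  | 0, _, _ => exact ⟨fun m => zero_mem _, zero_mem _⟩
  | 1, x, hx =>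
    refine ⟨fun m => Fin.cases (zero_mem _) (fun m => ?_) m, zero_mem _⟩
    exact ceDiff_mem_basicW hI ((hx 0).2.1 m.castSucc)
  | j + 2, x, hx =>
    refine ⟨fun m => ?_, ?_⟩
    · rw [obsBracket_fst]
      exact zsmul_mem (multiIns_mem_basicW hI (single_mem_basicW hωW) (fun i => (hx i).2.2) m) _
    · rw [obsBracket_snd]
      split_ifs
      exacts [lie_mem_normW (hx 0).2.2 (hx 1).2.2, zero_mem _]

theorem obsBracket_mem_hamN (hI : derN (K := K) I ≤ I • ⊤) (hω : ceDiff ω = 0)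
    (hωW : ω ∈ basicW I (symLR I F) (p + 2)) {n : ℕ} {x : Fin n → Amb K R p}
    (hx : ∀ i, x i ∈ hamW I F ω) {i : Fin n} (hi : x i ∈ hamN I F ω) :
    obsBracket ω n x ∈ hamN I F ω := by
  simp only [mem_hamW_iff] at hx
  rw [mem_hamN_iff] at hi ⊢
  refine ⟨obsBracket_mem_ham hω fun i => (hx i).1, ?_⟩
  match n, x, hx, i, hi with
  | 0, _, _, i, _ => exact i.elim0
  | 1, x, _, i, hi =>
    obtain rfl : i = 0 := Subsingleton.elim _ _
    refine ⟨fun m => Fin.cases (zero_mem _) (fun m => ?_) m, zero_mem _⟩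
    exact ceDiff_mem_formN (hi.2.1 m.castSucc)
  | j + 2, x, hx, i, hi =>
    refine ⟨fun m => ?_, ?_⟩
    · rw [obsBracket_fst]
      exact zsmul_mem
        (multiIns_mem_formN hI (single_mem_basicW hωW) (fun i => (hx i).2.2) i hi.2.2 m) _
    · rw [obsBracket_snd]
      split_ifs with h
      · subst h
        fin_cases i
        · exact (hx 1).2.2.2 _ hi.2.2
        · rw [← lie_skew]
          exact neg_mem ((hx 0).2.2.2 _ hi.2.2)
      · exact zero_mem _

end Reduction

/-! ### Hadamard's lemma -/

section Hadamard

open scoped ContDiff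

theorem hasFDerivAt_intervalIntegral {H G : Type*} [NormedAddCommGroup H] [NormedSpace ℝ H]
    [FiniteDimensional ℝ H] [NormedAddCommGroup G] [NormedSpace ℝ G] {f : H × ℝ → G}
    (hf : ContDiff ℝ 1 f) (a b : ℝ) (x₀ : H) :
    HasFDerivAt (fun x => ∫ t in a..b, f (x, t))
      (∫ t in a..b, (fderiv ℝ f (x₀, t)).comp (ContinuousLinearMap.inl ℝ H ℝ)) x₀ := by
  have hderiv : Continuous fun z : H × ℝ => (fderiv ℝ f z).comp (ContinuousLinearMap.inl ℝ H ℝ) :=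
    (hf.continuous_fderiv one_ne_zero).clm_comp continuous_const
  obtain ⟨C, hC⟩ := ((isCompact_closedBall x₀ 1).prod (isCompact_uIcc (a := a) (b := b)))
    |>.exists_bound_of_continuousOn hderiv.continuousOn
  refine intervalIntegral.hasFDerivAt_integral_of_dominated_of_fderiv_le (𝕜 := ℝ)
    (F := fun x t => f (x, t)) (bound := fun _ => C)
    (F' := fun x t => (fderiv ℝ f (x, t)).comp (ContinuousLinearMap.inl ℝ H ℝ))
    (Metric.closedBall_mem_nhds x₀ one_pos) ?_ ?_ ?_ ?_ intervalIntegrable_const ?_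
  · exact Filter.Eventually.of_forall fun x =>
      (hf.continuous.comp (Continuous.prodMk_right x)).aestronglyMeasurable
  · exact (hf.continuous.comp (Continuous.prodMk_right x₀)).intervalIntegrable _ _
  · exact (hderiv.comp (Continuous.prodMk_right x₀)).aestronglyMeasurable
  · exact Filter.Eventually.of_forall fun t ht x hx =>
      hC (x, t) ⟨hx, Set.uIoc_subset_uIcc ht⟩
  · exact Filter.Eventually.of_forall fun t _ x _ =>
      (hf.differentiable one_ne_zero (x, t)).hasFDerivAt.comp x (hasFDerivAt_prodMk_left x t)

theorem contDiff_intervalIntegral.{u} {H : Type u} [NormedAddCommGroup H] [NormedSpace ℝ H]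
    [FiniteDimensional ℝ H] (a b : ℝ) (n : ℕ) : ∀ {G : Type u} [NormedAddCommGroup G]
    [NormedSpace ℝ G] {f : H × ℝ → G}, ContDiff ℝ n f →
    ContDiff ℝ n fun x => ∫ t in a..b, f (x, t) := by
  induction n with
  | zero =>
    intro G _ _ f hf
    exact contDiff_zero.2 (intervalIntegral.continuous_parametric_intervalIntegral_of_continuous'
      (f := fun x t => f (x, t)) hf.continuous a b)
  | succ n ih =>
    intro G _ _ f hf
    have hderiv : ContDiff ℝ n fun z => (fderiv ℝ f z).comp (ContinuousLinearMap.inl ℝ H ℝ) :=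
      (hf.fderiv_right le_rfl).clm_comp contDiff_const
    exact (contDiff_succ_iff_hasFDerivAt (n := n)).2
      ⟨_, ih hderiv, hasFDerivAt_intervalIntegral (hf.of_le (by simp)) a b⟩

theorem integral_fderiv_segment {E G : Type*} [NormedAddCommGroup E] [NormedSpace ℝ E]
    [NormedAddCommGroup G] [NormedSpace ℝ G] [CompleteSpace G] {f : E → G} (hf : ContDiff ℝ 1 f)
    (x y : E) : ∫ t in (0 : ℝ)..1, fderiv ℝ f (x + t • (y - x)) (y - x) = f y - f x := by
  have hderiv (t : ℝ) : HasDerivAt (fun t : ℝ => f (x + t • (y - x)))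
      (fderiv ℝ f (x + t • (y - x)) (y - x)) t := by
    refine (hf.differentiable one_ne_zero _).hasFDerivAt.comp_hasDerivAt t ?_
    simpa only [id_eq, one_smul] using ((hasDerivAt_id t).smul_const (y - x)).const_add x
  have hcont : Continuous fun t : ℝ => fderiv ℝ f (x + t • (y - x)) (y - x) :=
    ((hf.continuous_fderiv one_ne_zero).comp (by fun_prop)).clm_apply continuous_const
  rw [intervalIntegral.integral_eq_sub_of_hasDerivAt (fun t _ => hderiv t)
    (hcont.intervalIntegrable _ _), one_smul, zero_smul, add_zero, add_sub_cancel]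

theorem clm_apply_eq_sum_single {n : ℕ} (L : EuclideanSpace ℝ (Fin n) →L[ℝ] ℝ)
    (v : EuclideanSpace ℝ (Fin n)) : L v = ∑ a, v a * L (EuclideanSpace.single a 1) := by
  conv_lhs => rw [← (EuclideanSpace.basisFun (Fin n) ℝ).sum_repr v, map_sum]
  simp only [map_smul, smul_eq_mul, EuclideanSpace.basisFun_repr, EuclideanSpace.basisFun_apply]

theorem hadamard {n : ℕ} {f : EuclideanSpace ℝ (Fin n) → ℝ} (hf : ContDiff ℝ ∞ f)
    (x : EuclideanSpace ℝ (Fin n)) :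
    ∃ k : Fin n → EuclideanSpace ℝ (Fin n) → ℝ, (∀ a, ContDiff ℝ ∞ (k a)) ∧
      (∀ y, f y = f x + ∑ a, (y a - x a) * k a y) ∧
      ∀ a, k a x = fderiv ℝ f x (EuclideanSpace.single a 1) := by
  have hsegment (a : Fin n) : ContDiff ℝ ∞ fun z : EuclideanSpace ℝ (Fin n) × ℝ =>
      fderiv ℝ f (x + z.2 • (z.1 - x)) (EuclideanSpace.single a 1) :=
    ((hf.fderiv_right (m := ∞) le_rfl).comp (by fun_prop)).clm_apply contDiff_const
  refine ⟨fun a y => ∫ t in (0 : ℝ)..1, fderiv ℝ f (x + t • (y - x)) (EuclideanSpace.single a 1),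
    fun a => contDiff_infty.2 fun m => contDiff_intervalIntegral 0 1 m
      (contDiff_infty.1 (hsegment a) m), fun y => ?_, fun a => by simp⟩
  have hint (a : Fin n) : IntervalIntegrable
      (fun t => fderiv ℝ f (x + t • (y - x)) (EuclideanSpace.single a 1))
      MeasureTheory.volume 0 1 :=
    ((hsegment a).continuous.comp (Continuous.prodMk_right y)).intervalIntegrable _ _
  rw [← sub_eq_iff_eq_add', ← integral_fderiv_segment (contDiff_infty.1 hf 1)]
  simp_rw [clm_apply_eq_sum_single _ (y - x)]
  rw [intervalIntegral.integral_finsetSum fun a _ => (hint a).const_mul _]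
  simp only [intervalIntegral.integral_const_mul, PiLp.sub_apply]

end Hadamard

/-! ### Derivations in a chart -/

section LocalDerivations

open scoped ContDiff Topology

variable {n : ℕ} {M : Type*} [TopologicalSpace M] [ChartedSpace (EuclideanSpace ℝ (Fin n)) M]

theorem smooth_sum_apply {J : Type*} (s : Finset J) (u : J → Smooth n M) (x : M) :
    (∑ j ∈ s, u j) x = ∑ j ∈ s, u j x :=
  map_sum (ContMDiffMap.evalRingHom x : Smooth n M →+* ℝ) u s

theorem derivation_sum_apply {J : Type*} (s : Finset J) (X : J → Der ℝ (Smooth n M))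
    (f : Smooth n M) (x : M) : (∑ j ∈ s, X j) f x = ∑ j ∈ s, X j f x := by
  rw [← Derivation.coeFnAddMonoidHom_apply, map_sum, Finset.sum_apply, smooth_sum_apply]
  rfl

section Chart

variable [IsManifold (𝓡 n) (⊤ : ℕ∞) M]

theorem contDiffOn_comp_extChartAt_symm (c : M) (f : Smooth n M) :
    ContDiffOn ℝ ∞ (f ∘ (extChartAt (𝓡 n) c).symm) (extChartAt (𝓡 n) c).target :=
  (f.contMDiff.comp_contMDiffOn (contMDiffOn_extChartAt_symm c)).contDiffOn

theorem contDiffAt_comp_extChartAt_symm {c x : M} (hx : x ∈ (extChartAt (𝓡 n) c).source)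
    (f : Smooth n M) :
    ContDiffAt ℝ ∞ (f ∘ (extChartAt (𝓡 n) c).symm) (extChartAt (𝓡 n) c x) :=
  (contDiffOn_comp_extChartAt_symm c f).contDiffAt
    ((isOpen_extChartAt_target c).mem_nhds ((extChartAt (𝓡 n) c).map_source hx))

end Chart

section Bump

variable [T2Space M] {c : M} (b : SmoothBumpFunction (𝓡 n) c)

theorem bump_eq_zero_of_notMem_source {x : M} (hx : x ∉ (extChartAt (𝓡 n) c).source) :
    b x = 0 := by
  by_contra h
  exact hx (b.tsupport_subset_extChartAt_source (subset_tsupport _ h))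

variable {b} in
theorem mem_source_of_eventuallyEq_one {x : M} (hx : b =ᶠ[𝓝 x] 1) :
    x ∈ (extChartAt (𝓡 n) c).source := by
  by_contra h
  exact one_ne_zero (hx.eq_of_nhds.symm.trans (bump_eq_zero_of_notMem_source b h))

variable {b} in
theorem eventually_target_and_eq_one {x : M} (hx : b =ᶠ[𝓝 x] 1) :
    ∀ᶠ z in 𝓝 (extChartAt (𝓡 n) c x),
      z ∈ (extChartAt (𝓡 n) c).target ∧ b ((extChartAt (𝓡 n) c).symm z) = 1 := by
  have hsource := mem_source_of_eventuallyEq_one hx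
  have hsymm := continuousAt_extChartAt_symm' (I := 𝓡 n) hsource
  rw [ContinuousAt, (extChartAt (𝓡 n) c).left_inv hsource] at hsymm
  filter_upwards [(isOpen_extChartAt_target c).mem_nhds
    ((extChartAt (𝓡 n) c).map_source hsource), hsymm.eventually hx] with z hz hbz using ⟨hz, hbz⟩

end Bump

variable [IsManifold (𝓡 n) (⊤ : ℕ∞) M] [T2Space M] {c : M} (b : SmoothBumpFunction (𝓡 n) c)

/-- A smooth bump function as an element of `C^∞(M)`. -/
def bumpFn : Smooth n M := ⟨b, b.contMDiff⟩

/-- The pullback of a function on Euclidean space along the chart at `c`, multiplied by a bump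
function to make it globally smooth. -/
def pullCutoff (k : EuclideanSpace ℝ (Fin n) → ℝ) (hk : ContDiff ℝ ∞ k) : Smooth n M :=
  ⟨fun x => b x • k (extChartAt (𝓡 n) c x),
    b.contMDiff_smul (hk.contMDiff.comp_contMDiffOn contMDiffOn_extChartAt)⟩

/-- The `a`-th coordinate function of the chart at `c`, multiplied by a bump function. -/
def coordFn (a : Fin n) : Smooth n M :=
  pullCutoff b (fun y => y a) (by fun_prop)

/-- A function multiplied by a bump function and read in the chart at `c`, extended by zero to all
of Euclidean space. -/
def pushCutoff (f : Smooth n M) : EuclideanSpace ℝ (Fin n) → ℝ :=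
  (extChartAt (𝓡 n) c).target.indicator ((bumpFn b * f : Smooth n M) ∘ (extChartAt (𝓡 n) c).symm)

variable {b} in
theorem pullCutoff_apply {k : EuclideanSpace ℝ (Fin n) → ℝ} (hk : ContDiff ℝ ∞ k) {x : M}
    (hx : b =ᶠ[𝓝 x] 1) : pullCutoff b k hk x = k (extChartAt (𝓡 n) c x) := by
  change b x * _ = _
  rw [hx.eq_of_nhds, Pi.one_apply, one_mul]

theorem pushCutoff_eq_zero_of_notMem_image {f : Smooth n M} {y : EuclideanSpace ℝ (Fin n)}
    (hy : y ∉ extChartAt (𝓡 n) c '' tsupport b) : pushCutoff b f y = 0 := by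
  refine Set.indicator_apply_eq_zero.2 fun hyt => ?_
  have hzero : b ((extChartAt (𝓡 n) c).symm y) = 0 := by
    by_contra h
    exact hy ⟨_, subset_tsupport _ h, (extChartAt (𝓡 n) c).right_inv hyt⟩
  change b _ * f _ = 0
  rw [hzero, zero_mul]

theorem contDiff_pushCutoff (f : Smooth n M) : ContDiff ℝ ∞ (pushCutoff b f) := by
  refine contDiff_iff_contDiffAt.2 fun y => ?_
  by_cases hy : y ∈ (extChartAt (𝓡 n) c).target
  · have hnhds := (isOpen_extChartAt_target (I := 𝓡 n) c).mem_nhds hy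
    refine ((contDiffOn_comp_extChartAt_symm c (bumpFn b * f)).contDiffAt hnhds)
      |>.congr_of_eventuallyEq ?_
    filter_upwards [hnhds] with z hz using Set.indicator_of_mem hz _
  · have hclosed : IsClosed (extChartAt (𝓡 n) c '' tsupport b) :=
      (b.hasCompactSupport.isCompact.image_of_continuousOn ((continuousOn_extChartAt c).mono
        b.tsupport_subset_extChartAt_source)).isClosed
    have hysupp : y ∉ extChartAt (𝓡 n) c '' tsupport b := by
      rintro ⟨x, hx, rfl⟩
      exact hy ((extChartAt (𝓡 n) c).map_source (b.tsupport_subset_extChartAt_source hx))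
    refine (contDiffAt_const (c := (0 : ℝ))).congr_of_eventuallyEq ?_
    filter_upwards [hclosed.isOpen_compl.mem_nhds hysupp] with z hz
      using pushCutoff_eq_zero_of_notMem_image b hz

variable {b} in
theorem pushCutoff_eventuallyEq {x : M} (hx : b =ᶠ[𝓝 x] 1) (f : Smooth n M) :
    pushCutoff b f =ᶠ[𝓝 (extChartAt (𝓡 n) c x)] f ∘ (extChartAt (𝓡 n) c).symm := by
  filter_upwards [eventually_target_and_eq_one hx] with z ⟨hz, hbz⟩
  rw [pushCutoff, Set.indicator_of_mem hz]
  change b _ * f _ = f _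
  rw [hbz, one_mul]

variable {b} in
theorem pushCutoff_apply_extChartAt {x : M} (hx : b =ᶠ[𝓝 x] 1) (f : Smooth n M) :
    pushCutoff b f (extChartAt (𝓡 n) c x) = f x := by
  rw [(pushCutoff_eventuallyEq hx f).eq_of_nhds, Function.comp_apply,
    (extChartAt (𝓡 n) c).left_inv (mem_source_of_eventuallyEq_one hx)]

/-- The partial derivative of `f` along the `a`-th coordinate of the chart at `c`, multiplied by a
bump function. -/
def partialFn (a : Fin n) (f : Smooth n M) : Smooth n M :=
  ⟨fun x => b x • fderiv ℝ (f ∘ (extChartAt (𝓡 n) c).symm) (extChartAt (𝓡 n) c x)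
      (EuclideanSpace.single a 1), b.contMDiff_smul <| by
    have hderiv := ((contDiffOn_comp_extChartAt_symm c f).fderiv_of_isOpen (m := ∞)
      (isOpen_extChartAt_target c) (by simp)).clm_apply
      (contDiffOn_const (c := EuclideanSpace.single a (1 : ℝ)))
    refine hderiv.contMDiffOn.comp (contMDiffOn_extChartAt (x := c)) fun x hx => ?_
    exact (extChartAt (𝓡 n) c).map_source (by simpa using hx)⟩

theorem partialFn_apply (a : Fin n) (f : Smooth n M) (x : M) :
    partialFn b a f x = b x * fderiv ℝ (f ∘ (extChartAt (𝓡 n) c).symm) (extChartAt (𝓡 n) c x)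
      (EuclideanSpace.single a 1) :=
  rfl

theorem partialFn_add (a : Fin n) (f g : Smooth n M) :
    partialFn b a (f + g) = partialFn b a f + partialFn b a g := by
  ext x
  simp only [ContMDiffMap.coe_add, Pi.add_apply, partialFn_apply, Pi.add_comp]
  by_cases hx : x ∈ (extChartAt (𝓡 n) c).source
  · rw [fderiv_add ((contDiffAt_comp_extChartAt_symm hx f).differentiableAt (by simp))
      ((contDiffAt_comp_extChartAt_symm hx g).differentiableAt (by simp)), ← mul_add]
    rfl
  · simp only [bump_eq_zero_of_notMem_source b hx, zero_mul, add_zero]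

theorem partialFn_smul (a : Fin n) (r : ℝ) (f : Smooth n M) :
    partialFn b a (r • f) = r • partialFn b a f := by
  ext x
  change b x * fderiv ℝ (r • (f ∘ (extChartAt (𝓡 n) c).symm)) _ _ = r * (b x * _)
  rw [fderiv_const_smul_field, mul_left_comm]
  rfl

theorem partialFn_mul (a : Fin n) (f g : Smooth n M) :
    partialFn b a (f * g) = f * partialFn b a g + g * partialFn b a f := by
  ext x
  simp only [ContMDiffMap.coe_add, ContMDiffMap.coe_mul, Pi.add_apply, Pi.mul_apply,
    partialFn_apply, Pi.mul_comp]
  by_cases hx : x ∈ (extChartAt (𝓡 n) c).source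
  · rw [fderiv_mul ((contDiffAt_comp_extChartAt_symm hx f).differentiableAt (by simp))
      ((contDiffAt_comp_extChartAt_symm hx g).differentiableAt (by simp))]
    simp only [Function.comp_apply, (extChartAt (𝓡 n) c).left_inv hx, add_apply, smul_apply,
      smul_eq_mul]
    ring
  · simp only [bump_eq_zero_of_notMem_source b hx, zero_mul, mul_zero, add_zero]

/-- The coordinate vector field `∂_a` of the chart at `c`, multiplied by a bump function. -/
def partialDer (a : Fin n) : Der ℝ (Smooth n M) :=
  Derivation.mk'
    { toFun := partialFn b a
      map_add' := partialFn_add b a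
      map_smul' := partialFn_smul b a }
    (partialFn_mul b a)

variable {b} in
theorem partialDer_apply {x : M} (hx : b =ᶠ[𝓝 x] 1) (a : Fin n) (f : Smooth n M) :
    partialDer b a f x =
      fderiv ℝ (pushCutoff b f) (extChartAt (𝓡 n) c x) (EuclideanSpace.single a 1) := by
  rw [(pushCutoff_eventuallyEq hx f).fderiv_eq]
  refine (partialFn_apply b a f x).trans ?_
  rw [hx.eq_of_nhds, Pi.one_apply, one_mul]

variable {b} in
theorem partialDer_coordFn {x : M} (hx : b =ᶠ[𝓝 x] 1) (a a' : Fin n) :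
    partialDer b a' (coordFn b a) x = if a = a' then 1 else 0 := by
  have hcoord : pushCutoff b (coordFn b a) =ᶠ[𝓝 (extChartAt (𝓡 n) c x)]
      (EuclideanSpace.proj a : EuclideanSpace ℝ (Fin n) →L[ℝ] ℝ) := by
    filter_upwards [pushCutoff_eventuallyEq hx (coordFn b a), eventually_target_and_eq_one hx]
      with z hpush ⟨hz, hbz⟩
    rw [hpush]
    change b _ * (extChartAt (𝓡 n) c ((extChartAt (𝓡 n) c).symm z)) a = z a
    rw [hbz, (extChartAt (𝓡 n) c).right_inv hz, one_mul]
  rw [partialDer_apply hx, hcoord.fderiv_eq, ContinuousLinearMap.fderiv]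
  simp

variable {b} in
theorem fderiv_pushCutoff_apply {x : M} (hx : b =ᶠ[𝓝 x] 1) (f : Smooth n M)
    (v : EuclideanSpace ℝ (Fin n)) :
    fderiv ℝ (pushCutoff b f) (extChartAt (𝓡 n) c x) v = ∑ a, v a * partialDer b a f x := by
  rw [clm_apply_eq_sum_single]
  simp only [partialDer_apply hx]

theorem derivation_congr_of_eventuallyEq (X : Der ℝ (Smooth n M)) {f g : Smooth n M} {x : M}
    (h : f =ᶠ[𝓝 x] g) : X f x = X g x := by
  obtain ⟨b, hb⟩ := (SmoothBumpFunction.nhds_basis_support (I := 𝓡 n) h).ex_mem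
  have hmul : bumpFn b * (f - g) = 0 := by
    ext z
    change b z * (f z - g z) = 0
    by_cases hz : b z = 0
    · rw [hz, zero_mul]
    · rw [show f z = g z from hb (subset_tsupport _ hz), sub_self, mul_zero]
  have hder : b x * (X f x - X g x) + (f x - g x) * X (bumpFn b) x = 0 := by
    have hleibniz := (X.leibniz (bumpFn b) (f - g)).symm.trans (congrArg X hmul)
    rw [map_sub, map_zero] at hleibniz
    exact congrArg (fun u : Smooth n M => u x) hleibniz
  rw [b.eq_one, h.eq_of_nhds, sub_self, zero_mul, one_mul, add_zero] at hder
  exact sub_eq_zero.1 hder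

variable {b} in
theorem exists_eventuallyEq_add_sum_coordFn {x : M} (hx : b =ᶠ[𝓝 x] 1) (f : Smooth n M) :
    ∃ k : Fin n → Smooth n M, (∀ a, k a x = partialDer b a f x) ∧
      f =ᶠ[𝓝 x] (algebraMap ℝ (Smooth n M) (f x) +
        ∑ a, (coordFn b a - algebraMap ℝ (Smooth n M) (coordFn b a x)) * k a : Smooth n M) := by
  obtain ⟨k, hk, hexpand, hkx⟩ := hadamard (contDiff_pushCutoff b f) (extChartAt (𝓡 n) c x)
  refine ⟨fun a => pullCutoff b (k a) (hk a), fun a => ?_, ?_⟩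
  · rw [pullCutoff_apply _ hx, hkx, partialDer_apply hx]
  · filter_upwards [hx.eventuallyEq_nhds] with z hz
    rw [← pushCutoff_apply_extChartAt hz, hexpand, pushCutoff_apply_extChartAt hx,
      ContMDiffMap.coe_add, Pi.add_apply, smooth_sum_apply]
    refine congrArg (f x + ·) (Finset.sum_congr rfl fun a _ => ?_)
    change _ = (coordFn b a z - coordFn b a x) * pullCutoff b (k a) (hk a) z
    simp only [coordFn, pullCutoff_apply _ hx, pullCutoff_apply _ hz]

variable {b} in
theorem derivation_apply_eq_sum (X : Der ℝ (Smooth n M)) (f : Smooth n M) {x : M}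
    (hx : b =ᶠ[𝓝 x] 1) : X f x = ∑ a, X (coordFn b a) x * partialDer b a f x := by
  obtain ⟨k, hkx, hf⟩ := exists_eventuallyEq_add_sum_coordFn hx f
  rw [derivation_congr_of_eventuallyEq X hf, map_add, Derivation.map_algebraMap, zero_add, map_sum,
    smooth_sum_apply]
  refine Finset.sum_congr rfl fun a _ => ?_
  rw [X.leibniz, map_sub, Derivation.map_algebraMap, sub_zero, ← hkx]
  change (coordFn b a x - coordFn b a x) * _ + k a x * _ = _
  rw [sub_self, zero_mul, zero_add, mul_comm]

end LocalDerivations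

/-! ### Generic linear combinations of countably many families of covectors -/

section GenericVectors

theorem eq_zero_of_sum_range_smul_eq_zero {K V W : Type*} [Field K] [AddCommGroup V] [Module K V]
    [AddCommGroup W] [Module K W] {D : ℕ → V →ₗ[K] K} {a : ℕ → W}
    (h : ∀ k v, ∑ j ∈ Finset.range k, D j v • a j + a k ≠ 0) {v : V} {m : ℕ}
    (hv : ∑ j ∈ Finset.range m, D j v • a j = 0) {j : ℕ} (hj : j < m) : D j v = 0 := by
  induction m with
  | zero => exact absurd hj j.not_lt_zero
  | succ m ih =>
    rw [Finset.sum_range_succ] at hv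
    have hlast : D m v = 0 := by
      by_contra hne
      refine h m ((D m v)⁻¹ • v) ?_
      have hscaled := congrArg ((D m v)⁻¹ • ·) hv
      simpa only [smul_add, Finset.smul_sum, smul_smul, inv_mul_cancel₀ hne, one_smul, smul_zero,
        map_smul, smul_eq_mul] using hscaled
    rw [hlast, zero_smul, add_zero] at hv
    rcases Nat.lt_succ_iff_lt_or_eq.1 hj with hj | rfl
    · exact ih hv hj
    · exact hlast

variable {E ι : Type*} [NormedAddCommGroup E] [NormedSpace ℝ E] [FiniteDimensional ℝ E]
  [Countable ι] {N : ℕ}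

theorem exists_sum_smul_add_ne_zero (hN : 2 * Module.finrank ℝ E < N)
    {D : ι → ℕ → E → (E →L[ℝ] ℝ)} (hD : ∀ i j, ContDiff ℝ 1 (D i j)) (k : ℕ)
    (p : ℕ → Fin N → ℝ) :
    ∃ w : Fin N → ℝ, ∀ i y v, ∑ j ∈ Finset.range k, D i j y v • p j + w ≠ 0 := by
  have hdim : dimH (⋃ i, Set.range fun z : E × E => -∑ j ∈ Finset.range k, D i j z.1 z.2 • p j) <
      Module.finrank ℝ (Fin N → ℝ) := by
    rw [dimH_iUnion]
    refine (iSup_le fun i => ContDiff.dimH_range_le (ContDiff.neg (ContDiff.sum fun j _ =>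
      ((((hD i j).comp contDiff_fst).clm_apply contDiff_snd).smul contDiff_const)))).trans_lt ?_
    rw [Module.finrank_prod, ← two_mul, Module.finrank_fin_fun]
    exact_mod_cast hN
  obtain ⟨w, hw⟩ := (dense_compl_of_dimH_lt_finrank hdim).nonempty
  exact ⟨w, fun i y v h =>
    hw (Set.mem_iUnion.2 ⟨i, (y, v), (eq_neg_of_add_eq_zero_right h).symm⟩)⟩

theorem exists_generic_vectors (hN : 2 * Module.finrank ℝ E < N)
    {D : ι → ℕ → E → (E →L[ℝ] ℝ)} (hD : ∀ i j, ContDiff ℝ 1 (D i j)) :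
    ∃ a : ℕ → Fin N → ℝ, ∀ i y v m, ∑ j ∈ Finset.range m, D i j y v • a j = 0 →
      ∀ j < m, D i j y v = 0 := by
  choose w hw using exists_sum_smul_add_ne_zero hN hD
  let a : ℕ → Fin N → ℝ := Nat.lt_wfRel.wf.fix fun k earlier =>
    w k fun j => if h : j < k then earlier j h else 0
  have ha (k : ℕ) : a k = w k fun j => if j < k then a j else 0 := Nat.lt_wfRel.wf.fix_eq _ k
  refine ⟨a, fun i y v m hv j hj =>
    eq_zero_of_sum_range_smul_eq_zero (D := fun j => (D i j y).toLinearMap) (fun k v => ?_) hv hj⟩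
  have hgeneric := hw k (fun j => if j < k then a j else 0) i y v
  rwa [← ha, Finset.sum_congr rfl fun j hj => by rw [if_pos (Finset.mem_range.1 hj)]] at hgeneric

end GenericVectors

/-! ### Finitely many functions whose differentials span every cotangent space -/

section SeparatingFunctions

open scoped ContDiff Topology

theorem locallyFinite_extend_empty {X ι κ : Type*} [TopologicalSpace X] {f : ι → Set X}
    (hf : LocallyFinite f) (e : ι → κ) : LocallyFinite (Function.extend e f fun _ => ∅) :=
    fun x => by
  classical
  obtain ⟨U, hU, hfin⟩ := hf x
  refine ⟨U, hU, (hfin.image e).subset fun j hj => ?_⟩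
  by_cases h : ∃ i, e i = j
  · rw [Set.mem_ofPred_eq, Function.extend_def, dif_pos h] at hj
    exact ⟨h.choose, hj, h.choose_spec⟩
  · rw [Set.mem_ofPred_eq, Function.extend_apply' _ _ _ h, Set.empty_inter] at hj
    exact absurd hj Set.not_nonempty_empty

universe u

variable {n : ℕ} {M : Type u} [TopologicalSpace M] [ChartedSpace (EuclideanSpace ℝ (Fin n)) M]

/-- The sum of a locally finite family of smooth functions. -/
def locallyFiniteSum {J : Type*} (g : J → Smooth n M)
    (hg : LocallyFinite fun j => Function.support (g j)) : Smooth n M :=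
  ⟨fun x => ∑ᶠ j, g j x, contMDiff_finsum (fun j => (g j).contMDiff) hg⟩

theorem locallyFiniteSum_eventuallyEq {J : Type*} {g : J → Smooth n M}
    (hg : LocallyFinite fun j => Function.support (g j)) {x : M} {s : Finset J} {U : Set M}
    (hU : U ∈ 𝓝 x) (hs : ∀ j, (Function.support (g j) ∩ U).Nonempty → j ∈ s) :
    locallyFiniteSum g hg =ᶠ[𝓝 x] (∑ j ∈ s, g j : Smooth n M) := by
  filter_upwards [hU] with z hz
  rw [smooth_sum_apply]
  exact finsum_eq_sum_of_support_subset _ fun j hj => hs j ⟨z, hj, hz⟩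

variable [IsManifold (𝓡 n) (⊤ : ℕ∞) M] [T2Space M]

theorem derivation_locallyFiniteSum_apply {J : Type*} (X : Der ℝ (Smooth n M))
    {g : J → Smooth n M} (hg : LocallyFinite fun j => Function.support (g j)) {x : M}
    {s : Finset J} {U : Set M} (hU : U ∈ 𝓝 x)
    (hs : ∀ j, (Function.support (g j) ∩ U).Nonempty → j ∈ s) :
    X (locallyFiniteSum g hg) x = ∑ j ∈ s, X (g j) x := by
  rw [derivation_congr_of_eventuallyEq X (locallyFiniteSum_eventuallyEq hg hU hs), map_sum,
    smooth_sum_apply]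

theorem exists_functions_separating_as_locallyFinite_family {ι : Type*} [Countable ι] {c : ι → M}
    (b : ∀ i, SmoothBumpFunction (𝓡 n) (c i)) {g : ℕ → Smooth n M}
    (hg : LocallyFinite fun j => Function.support (g j)) :
    ∃ H : Fin (2 * n + 1) → Smooth n M, ∀ i x, b i =ᶠ[𝓝 x] 1 → ∀ v : Fin n → ℝ,
      (∀ l, ∑ a, v a * partialDer (b i) a (H l) x = 0) →
        ∀ j, ∑ a, v a * partialDer (b i) a (g j) x = 0 := by
  obtain ⟨w, hw⟩ := exists_generic_vectors (E := EuclideanSpace ℝ (Fin n)) (N := 2 * n + 1)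
    (by rw [finrank_euclideanSpace_fin]; exact Nat.lt_succ_self _)
    (D := fun i j => fderiv ℝ (pushCutoff (b i) (g j)))
    fun i j => ((contDiff_pushCutoff (b i) (g j)).fderiv_right (m := ∞) (by simp)).of_le
      (by exact_mod_cast le_top)
  have hwg (l : Fin (2 * n + 1)) :
      LocallyFinite fun j => Function.support (w j l • g j : Smooth n M) :=
    hg.subset fun j => Function.support_const_smul_subset _ _
  refine ⟨fun l => locallyFiniteSum (fun j => w j l • g j) (hwg l), fun i x hx v hv j => ?_⟩
  obtain ⟨U, hU, hfin⟩ := hg x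
  obtain ⟨m, hm⟩ := (insert j hfin.toFinset).exists_nat_subset_range
  rw [Finset.insert_subset_iff] at hm
  have hder (l : Fin (2 * n + 1)) (a : Fin n) :
      partialDer (b i) a (locallyFiniteSum (fun j => w j l • g j) (hwg l)) x =
        ∑ j ∈ Finset.range m, w j l * partialDer (b i) a (g j) x := by
    rw [derivation_locallyFiniteSum_apply _ (hwg l) hU fun j hj => hm.2 (hfin.mem_toFinset.2
      (hj.mono (Set.inter_subset_inter_left _ (Function.support_const_smul_subset _ _))))]
    refine Finset.sum_congr rfl fun j _ => ?_
    rw [Derivation.map_smul]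
    rfl
  have hzero := hw i (extChartAt (𝓡 n) (c i) x) (WithLp.toLp 2 v) m
  simp only [fderiv_pushCutoff_apply hx] at hzero
  refine hzero (funext fun l => ?_) j (Finset.mem_range.1 hm.1)
  rw [Finset.sum_apply, Pi.zero_apply, ← hv l]
  simp only [hder, Pi.smul_apply, smul_eq_mul, Finset.mul_sum, Finset.sum_mul]
  rw [Finset.sum_comm]
  exact Finset.sum_congr rfl fun a _ => Finset.sum_congr rfl fun j _ => by ring

theorem locallyFinite_support_coordFn {ι : Type*} {c : ι → M}
    {b : ∀ i, SmoothBumpFunction (𝓡 n) (c i)} (hb : LocallyFinite fun i => Function.support (b i)) :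
    LocallyFinite fun q : ι × Fin n => Function.support (coordFn (b q.1) q.2) := fun x => by
  obtain ⟨U, hU, hfin⟩ := hb x
  refine ⟨U, hU, (hfin.prod (Set.finite_univ (α := Fin n))).subset ?_⟩
  exact fun q hq => ⟨hq.mono (Set.inter_subset_inter_left _
    (Function.support_smul_subset_left _ _)), Set.mem_univ _⟩

theorem exists_separating_functions [SecondCountableTopology M] :
    ∃ (ι : Type u) (fs : SmoothBumpCovering ι (𝓡 n) M) (H : Fin (2 * n + 1) → Smooth n M),
      ∀ i x, fs i =ᶠ[𝓝 x] 1 → ∀ v : Fin n → ℝ,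
        (∀ l, ∑ a, v a * partialDer (fs i) a (H l) x = 0) → v = 0 := by
  have := ChartedSpace.locallyCompactSpace (EuclideanSpace ℝ (Fin n)) M
  obtain ⟨ι, fs, -⟩ := SmoothBumpCovering.exists_isSubordinate (𝓡 n) (M := M) isClosed_univ
    (U := fun _ => Set.univ) fun _ _ => Filter.univ_mem
  have : Countable ι := Set.countable_univ_iff.1
    (fs.locallyFinite.countable_univ fun i => (fs i).nonempty_support)
  obtain ⟨e, he⟩ := exists_injective_nat (ι × Fin n)
  let g : ℕ → Smooth n M := Function.extend e (fun q => coordFn (fs q.1) q.2) 0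
  have hg : LocallyFinite fun j => Function.support (g j) := by
    convert locallyFinite_extend_empty (locallyFinite_support_coordFn fs.locallyFinite) e with j
    rw [Function.apply_extend fun u : Smooth n M => Function.support u]
    congr 1
    exact funext fun _ => Function.support_zero
  obtain ⟨H, hH⟩ := exists_functions_separating_as_locallyFinite_family (fun i => fs i) hg
  refine ⟨ι, fs, H, fun i x hx v hv => funext fun a => ?_⟩
  have hcoord := hH i x hx v hv (e (i, a))
  rw [show g (e (i, a)) = coordFn (fs i) a from he.extend_apply _ _ _] at hcoord
  simpa only [partialDer_coordFn hx, mul_ite, mul_one, mul_zero, Finset.sum_ite_eq,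
    Finset.mem_univ, if_true, Pi.zero_apply] using hcoord

end SeparatingFunctions

/-! ### Vector fields form a finitely generated module -/

section FiniteGeneration

open scoped ContDiff Topology Matrix

theorem sum_mulVec_mul_adjugate {A m n : Type*} [CommRing A] [Fintype m] [Fintype n]
    [DecidableEq n] (J : Matrix m n A) (u p : n → A) :
    ∑ l, (J *ᵥ u) l * ∑ a, ((Jᵀ * J).adjugate * Jᵀ) a l * p a = (Jᵀ * J).det * (u ⬝ᵥ p) := by
  calc ∑ l, (J *ᵥ u) l * ∑ a, ((Jᵀ * J).adjugate * Jᵀ) a l * p a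
      = (J *ᵥ u) ⬝ᵥ (p ᵥ* ((Jᵀ * J).adjugate * Jᵀ)) := by
        simp only [dotProduct, Matrix.vecMul, mul_comm (p _)]
    _ = (((Jᵀ * J).adjugate * Jᵀ) *ᵥ (J *ᵥ u)) ⬝ᵥ p := by
        rw [dotProduct_comm, ← Matrix.dotProduct_mulVec, dotProduct_comm]
    _ = (Jᵀ * J).det * (u ⬝ᵥ p) := by
        rw [Matrix.mulVec_mulVec, Matrix.mul_assoc, Matrix.adjugate_mul, Matrix.smul_mulVec,
          Matrix.one_mulVec, smul_dotProduct, smul_eq_mul]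

theorem det_transpose_mul_self_ne_zero {m n : Type*} [Fintype m] [Fintype n] [DecidableEq n]
    {J : Matrix m n ℝ} (hJ : ∀ v, J *ᵥ v = 0 → v = 0) : (Jᵀ * J).det ≠ 0 := fun hdet => by
  obtain ⟨v, hv, hmul⟩ := Matrix.exists_mulVec_eq_zero_iff.2 hdet
  have hker : v ∈ LinearMap.ker (Jᵀ * J).mulVecLin := hmul
  rw [Matrix.ker_mulVecLin_transpose_mul_self] at hker
  exact hv (hJ v hker)

universe u

variable {n : ℕ} {M : Type u} [TopologicalSpace M] [ChartedSpace (EuclideanSpace ℝ (Fin n)) M]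

theorem locallyFinite_support_mul {J : Type*} {r : J → Smooth n M}
    (hr : LocallyFinite fun j => Function.support (r j)) (u : J → Smooth n M) :
    LocallyFinite fun j => Function.support (r j * u j : Smooth n M) :=
  hr.subset fun _ => Function.support_mul_subset_left _ _

theorem locallyFiniteSum_mul_apply {J : Type*} {r : J → Smooth n M}
    (hr : LocallyFinite fun j => Function.support (r j)) (u : J → Smooth n M) (x : M) :
    locallyFiniteSum (fun j => r j * u j) (locallyFinite_support_mul hr u) x =
      ∑ j ∈ (hr.point_finite x).toFinset, r j x * u j x :=
  finsum_eq_sum_of_support_subset _ fun j hj => by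
    simpa using left_ne_zero_of_mul (hj : r j x * u j x ≠ 0)

/-- The sum `∑ r_j Z_j` of derivations with coefficients in a locally finite family of
functions. -/
def locallyFiniteSumDer {J : Type*} (r : J → Smooth n M)
    (hr : LocallyFinite fun j => Function.support (r j)) (Z : J → Der ℝ (Smooth n M)) :
    Der ℝ (Smooth n M) :=
  Derivation.mk'
    { toFun := fun f => locallyFiniteSum (fun j => r j * Z j f)
        (locallyFinite_support_mul hr _)
      map_add' := fun f g => by
        ext x
        rw [ContMDiffMap.coe_add, Pi.add_apply]
        simp only [locallyFiniteSum_mul_apply hr]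
        rw [← Finset.sum_add_distrib]
        exact Finset.sum_congr rfl fun j _ => by rw [map_add, ← mul_add]; rfl
      map_smul' := fun c f => by
        ext x
        rw [RingHom.id_apply, ContMDiffMap.coe_smul, Pi.smul_apply]
        simp only [locallyFiniteSum_mul_apply hr]
        rw [Finset.smul_sum]
        exact Finset.sum_congr rfl fun j _ => by
          rw [Derivation.map_smul, ← mul_smul_comm]; rfl }
    fun f g => by
      ext x
      change locallyFiniteSum (fun j => r j * Z j (f * g)) (locallyFinite_support_mul hr _) x =
        f x * locallyFiniteSum (fun j => r j * Z j g) (locallyFinite_support_mul hr _) x +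
          g x * locallyFiniteSum (fun j => r j * Z j f) (locallyFinite_support_mul hr _) x
      simp only [locallyFiniteSum_mul_apply hr]
      rw [Finset.mul_sum, Finset.mul_sum, ← Finset.sum_add_distrib]
      refine Finset.sum_congr rfl fun j _ => ?_
      rw [(Z j).leibniz]
      change r j x * (f x * Z j g x + g x * Z j f x) = _
      ring

theorem locallyFiniteSumDer_apply {J : Type*} {r : J → Smooth n M}
    (hr : LocallyFinite fun j => Function.support (r j)) (Z : J → Der ℝ (Smooth n M))
    (f : Smooth n M) (x : M) : locallyFiniteSumDer r hr Z f x =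
      ∑ j ∈ (hr.point_finite x).toFinset, r j x * Z j f x :=
  locallyFiniteSum_mul_apply hr _ x

variable [IsManifold (𝓡 n) (⊤ : ℕ∞) M] [T2Space M]

theorem exists_local_generators {c : M} (b : SmoothBumpFunction (𝓡 n) c) {N : ℕ}
    {H : Fin N → Smooth n M}
    (hH : ∀ x, b =ᶠ[𝓝 x] 1 → ∀ v : Fin n → ℝ,
      (∀ l, ∑ a, v a * partialDer b a (H l) x = 0) → v = 0) :
    ∃ (δ : Smooth n M) (W : Fin N → Der ℝ (Smooth n M)), ∀ x, b =ᶠ[𝓝 x] 1 → δ x ≠ 0 ∧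
      ∀ (X : Der ℝ (Smooth n M)) (f : Smooth n M), δ x * X f x = ∑ l, X (H l) x * W l f x := by
  let J : Matrix (Fin N) (Fin n) (Smooth n M) := Matrix.of fun l a => partialDer b a (H l)
  refine ⟨(Jᵀ * J).det, fun l => ∑ a, ((Jᵀ * J).adjugate * Jᵀ) a l • partialDer b a,
    fun x hx => ⟨?_, fun X f => ?_⟩⟩
  · let eval : Smooth n M →+* ℝ := ContMDiffMap.evalRingHom x
    have hdet : (Jᵀ * J).det x = ((J.map eval)ᵀ * J.map eval).det :=
      (RingHom.map_det eval _).trans (congrArg Matrix.det Matrix.map_mul)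
    rw [hdet]
    refine det_transpose_mul_self_ne_zero fun v hv => hH x hx v fun l => ?_
    exact (Finset.sum_congr rfl fun a _ => mul_comm _ _).trans (congrFun hv l)
  · let u : Fin n → Smooth n M := fun a => X (coordFn b a)
    have hJu (l : Fin N) : (J *ᵥ u) l x = X (H l) x := by
      rw [derivation_apply_eq_sum X (H l) hx, Matrix.mulVec, dotProduct, smooth_sum_apply]
      exact Finset.sum_congr rfl fun a _ => mul_comm _ _
    have hu : (u ⬝ᵥ fun a => partialDer b a f) x = X f x := by
      rw [derivation_apply_eq_sum X f hx, dotProduct, smooth_sum_apply]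
      rfl
    have hcramer := congrArg (fun s : Smooth n M => s x)
      (sum_mulVec_mul_adjugate J u fun a => partialDer b a f)
    simp only [smooth_sum_apply, ContMDiffMap.coe_mul, Pi.mul_apply, hJu, hu] at hcramer
    rw [← hcramer]
    refine Finset.sum_congr rfl fun l _ => ?_
    rw [derivation_sum_apply]
    rfl

theorem exists_locallyFinite_sum_mul_eq_one [SecondCountableTopology M] {ι : Type*}
    {U : ι → Set M} (hU : ∀ i, IsOpen (U i)) (hcover : ⋃ i, U i = Set.univ)
    {δ : ι → Smooth n M} (hδ : ∀ i, ∀ x ∈ U i, δ i x ≠ 0) :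
    ∃ (ψ : ι → Smooth n M) (hψ : LocallyFinite fun i => Function.support (ψ i)),
      (∀ i, Function.support (ψ i) ⊆ U i) ∧
        ∀ x, ∑ i ∈ (hψ.point_finite x).toFinset, ψ i x * δ i x = 1 := by
  have := ChartedSpace.locallyCompactSpace (EuclideanSpace ℝ (Fin n)) M
  obtain ⟨ρ, hρ⟩ := SmoothPartitionOfUnity.exists_isSubordinate (𝓡 n) isClosed_univ U hU
    hcover.ge
  let ψ : ι → Smooth n M := fun i => ⟨fun x => ρ i x • (δ i x)⁻¹, ρ.contMDiff_smul fun x hx =>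
    (δ i).contMDiff.contMDiffAt.inv₀ (hδ i x (hρ i hx))⟩
  have hsupp (i : ι) : Function.support (ψ i) ⊆ Function.support (ρ i) :=
    Function.support_smul_subset_left _ _
  refine ⟨ψ, ρ.locallyFinite.subset hsupp,
    fun i => ((hsupp i).trans (subset_tsupport _)).trans (hρ i), fun x => ?_⟩
  rw [← ρ.sum_eq_one (Set.mem_univ x)]
  have hψδ (i : ι) (hi : ρ i x ≠ 0) : ψ i x * δ i x = ρ i x :=
    inv_mul_cancel_right₀ (hδ i x (hρ i (subset_tsupport _ hi))) _
  rw [finsum_eq_sum_of_support_subset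
    (s := ((ρ.locallyFinite.subset hsupp).point_finite x).toFinset) _ fun i hi => ?_]
  · exact Finset.sum_congr rfl fun i hi => hψδ i (hsupp i (by simpa using hi))
  · simpa using left_ne_zero_of_mul ((hψδ i hi).trans_ne hi)

theorem exists_generators [SecondCountableTopology M] :
    ∃ (N : ℕ) (H : Fin N → Smooth n M) (Y : Fin N → Der ℝ (Smooth n M)),
      ∀ X : Der ℝ (Smooth n M), X = ∑ l, X (H l) • Y l := by
  obtain ⟨ι, fs, H, hH⟩ := exists_separating_functions (n := n) (M := M)
  choose δ W hW using fun i => exists_local_generators (fs i) (hH i)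
  obtain ⟨ψ, hψ, hψU, hsum⟩ := exists_locallyFinite_sum_mul_eq_one (n := n)
    (U := fun i => {x : M | fs i =ᶠ[𝓝 x] 1}) (fun i => isOpen_setOfPred_eventually_nhds)
    (Set.eq_univ_of_forall fun x => Set.mem_iUnion.2 ⟨_, fs.eventuallyEq_one x (Set.mem_univ x)⟩)
    fun i x hx => (hW i x hx).1
  refine ⟨2 * n + 1, H, fun l => locallyFiniteSumDer ψ hψ fun i => W i l, fun X => ?_⟩
  ext f x
  calc X f x = ∑ i ∈ (hψ.point_finite x).toFinset, ψ i x * (δ i x * X f x) := by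
        simp only [← mul_assoc, ← Finset.sum_mul, hsum, one_mul]
    _ = ∑ i ∈ (hψ.point_finite x).toFinset, ψ i x * ∑ l, X (H l) x * W i l f x :=
        Finset.sum_congr rfl fun i hi => by rw [(hW i x (hψU i (by simpa using hi))).2]
    _ = ∑ l, X (H l) x * ∑ i ∈ (hψ.point_finite x).toFinset, ψ i x * W i l f x := by
        simp only [Finset.mul_sum, mul_left_comm (ψ _ x)]
        exact Finset.sum_comm
    _ = (∑ l, X (H l) • locallyFiniteSumDer ψ hψ fun i => W i l) f x := by
        simp only [derivation_sum_apply, ← locallyFiniteSumDer_apply hψ]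
        rfl

theorem derN_le_smul_top [SecondCountableTopology M] (I : Ideal (Smooth n M)) :
    derN (K := ℝ) I ≤ I • (⊤ : Submodule (Smooth n M) (Der ℝ (Smooth n M))) := fun X hX => by
  obtain ⟨N, H, Y, hY⟩ := exists_generators (n := n) (M := M)
  rw [hY X]
  exact Submodule.sum_mem _ fun l _ => Submodule.smul_mem_smul (hX (H l)) Submodule.mem_top

end FiniteGeneration

end

end ConstraintReduction

open ConstraintReduction in
theorem mainTheorem5_general {K : Type*} [Field K] [CharZero K] {R : Type*} [CommRing R]
    [Algebra K R] {I : Ideal R} (hI : derN (K := K) I ≤ I • ⊤)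
    (F : LieSubalgebra K (Der K R)) (hF : ∀ ξ ∈ F, ξ ∈ derW I)
    (p : ℕ) (ω : Form K R (p + 2)) (hω : ceDiff ω = 0)
    (hωF : ∀ ξ ∈ F, ∀ v : Fin (p + 1) → Der K R, (∀ i, v i ∈ derW I) →
      ω (Matrix.vecCons ξ v) ∈ I) :
    let 𝓕 : Submodule R (Der K R) := Submodule.span R (F : Set (Der K R)) ⊔ I • ⊤
    symLR I (F : Set (Der K R)) = 𝓕 ∧
    (∃ Λ : LInfinityAlgebra K (hamGrade ω), ∀ (j : ℕ) (x : Fin j → ham ω),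
      (Λ.l j x : Amb K R p) = obsBracket ω j fun i => (x i : Amb K R p)) ∧
    hamN I (F : Set (Der K R)) ω ≤ hamW I (F : Set (Der K R)) ω ∧
    (∃ Λ : LInfinityAlgebra K (redGrade I (F : Set (Der K R)) ω),
      ∀ (j : ℕ) (x : Fin j → hamW I (F : Set (Der K R)) ω),
        ∃ h : obsBracket ω j (fun i => (x i : Amb K R p)) ∈ hamW I (F : Set (Der K R)) ω,
          Λ.l j (fun i => Submodule.Quotient.mk (x i)) = Submodule.Quotient.mk ⟨_, h⟩) ∧
    (∀ x : Amb K R p, x ∈ hamW I (F : Set (Der K R)) ω ↔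
      (∀ m : Fin (p + 1), ∀ ξ ∈ F,
        contr ξ (x.1 m) ∈ formN I (m - 1 : ℕ) ∧ lieDer ξ (x.1 m) ∈ formN I m) ∧
      (contr x.2 ω : Form K R (p + 1)) = -ceDiff (x.1 (Fin.last p)) ∧
      x.2 ∈ derW I ∧
      ∀ ξ ∈ F, ⁅ξ, x.2⁆ ∈ 𝓕) ∧
    (∀ x : Amb K R p, x ∈ hamN I (F : Set (Der K R)) ω ↔
      (∀ m : Fin (p + 1), x.1 m ∈ formN I m) ∧
      (contr x.2 ω : Form K R (p + 1)) = -ceDiff (x.1 (Fin.last p)) ∧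
      x.2 ∈ 𝓕) := by
  have hsym := symLR_eq_spanLR hF hI
  have hωW := mem_basicW_symLR_of_ceDiff_eq_zero hF hI hω hωF
  have hNW := hamN_le_hamW hF hI ω
  refine ⟨hsym, ?_, hNW, ?_, fun x => ?_, fun x => ?_⟩
  · exact ⟨obsLInfinity hω le_rfl (isGradedSubmodule_ham ω) fun _ _ => obsBracket_mem_ham hω,
      fun j x => obsLInfinity_l hω le_rfl (isGradedSubmodule_ham ω) _ j x⟩
  · exact exists_quotient_lInfinity hω inf_le_left (isGradedSubmodule_hamW I _ ω)
      (fun _ _ => obsBracket_mem_hamW hI hω hωW) hNW (isGradedSubmodule_hamN I _ ω)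
      fun _ _ hx ⟨_, hi⟩ => obsBracket_mem_hamN hI hω hωW hx hi
  · rw [mem_hamW_iff, mem_normW_symLR_iff hF hI]
    simp only [mem_basicW_symLR_iff hF hI]
    exact and_left_comm
  · rw [mem_hamN_iff, hsym]
    exact and_left_comm

open ConstraintReduction in
theorem mainTheorem5 {n : ℕ} {M : Type*} [TopologicalSpace M]
    [ChartedSpace (EuclideanSpace ℝ (Fin n)) M] [IsManifold (𝓡 n) (⊤ : ℕ∞) M] [T2Space M]
    [SecondCountableTopology M]
    (S : Set M) (hS : IsClosed S) (I : Ideal (Smooth n M)) (hI : I = vanishingIdeal S)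
    (F : LieSubalgebra ℝ (Der ℝ (Smooth n M))) (hF : ∀ ξ ∈ F, ξ ∈ derW I)
    (p : ℕ) (ω : Form ℝ (Smooth n M) (p + 2)) (hω : ceDiff ω = 0)
    (hωF : ∀ ξ ∈ F, ∀ v : Fin (p + 1) → Der ℝ (Smooth n M), (∀ i, v i ∈ derW I) →
      ω (Matrix.vecCons ξ v) ∈ I) :
    let 𝓕 : Submodule (Smooth n M) (Der ℝ (Smooth n M)) :=
      Submodule.span (Smooth n M) (F : Set (Der ℝ (Smooth n M))) ⊔ I • ⊤
    symLR I (F : Set (Der ℝ (Smooth n M))) = 𝓕 ∧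
    (∃ Λ : LInfinityAlgebra ℝ (hamGrade ω),
      ∀ (j : ℕ) (x : Fin j → ham ω), (Λ.l j x : Amb ℝ (Smooth n M) p) =
        obsBracket ω j fun i => (x i : Amb ℝ (Smooth n M) p)) ∧
    hamN I (F : Set (Der ℝ (Smooth n M))) ω ≤ hamW I (F : Set (Der ℝ (Smooth n M))) ω ∧
    (∃ Λ : LInfinityAlgebra ℝ (redGrade I (F : Set (Der ℝ (Smooth n M))) ω),
      ∀ (j : ℕ) (x : Fin j → hamW I (F : Set (Der ℝ (Smooth n M))) ω),
        ∃ h : obsBracket ω j (fun i => (x i : Amb ℝ (Smooth n M) p)) ∈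
            hamW I (F : Set (Der ℝ (Smooth n M))) ω,
          Λ.l j (fun i => Submodule.Quotient.mk (x i)) = Submodule.Quotient.mk ⟨_, h⟩) ∧
    (∀ x : Amb ℝ (Smooth n M) p, x ∈ hamW I (F : Set (Der ℝ (Smooth n M))) ω ↔
      (∀ m : Fin (p + 1), ∀ ξ ∈ F,
        contr ξ (x.1 m) ∈ formN I (m - 1 : ℕ) ∧ lieDer ξ (x.1 m) ∈ formN I m) ∧
      (contr x.2 ω : Form ℝ (Smooth n M) (p + 1)) = -ceDiff (x.1 (Fin.last p)) ∧
      x.2 ∈ derW I ∧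
      ∀ ξ ∈ F, ⁅ξ, x.2⁆ ∈ 𝓕) ∧
    (∀ x : Amb ℝ (Smooth n M) p, x ∈ hamN I (F : Set (Der ℝ (Smooth n M))) ω ↔
      (∀ m : Fin (p + 1), x.1 m ∈ formN I m) ∧
      (contr x.2 ω : Form ℝ (Smooth n M) (p + 1)) = -ceDiff (x.1 (Fin.last p)) ∧
      x.2 ∈ 𝓕) :=
  mainTheorem5_general (derN_le_smul_top I) F hF p ω hω hωF
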